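/- Let $n\ge 2$ be an integer. For $p\in(0,1)$, Mandelbrot's fractal percolation with parameters $(p,n)$ is the following random process. Put $M_0=[0,1]^2$ and divide it into $n^2$ equal closed sub-squares of side length $1/n$; keep each of them independently with probability $p$, and let $M_1$ be the union of the kept ones. Divide each kept square again into $n^2$ equal closed sub-squares of side length $1/n^2$, and keep each of these with probability $p$, independently of each other and of all earlier choices; let $M_2$ be the union of the kept ones; and so on. The limit set is $M=M^{(p,n)}=\bigcap_{k\ge 1}M_k$. For a metric space $X$, the topological Hausdorff dimension $\dim_{tH}X$ is $-1$ if $X=\emptyset$, and otherwise $$\dim_{tH}X=\inf\{d : X \text{ has a basis } \mathcal U \text{ of open sets such that } \dim_H\partial U\le d-1 \text{ for every } U\in\mathcal U\},$$ where $d=\infty$ is allowed (with $\infty-1=\infty$), $\dim_H$ is the Hausdorff dimension, and $\dim_H\emptyset=-1$. **Theorem.** For every integer $n\ge2$ and every $d\in[0,2)$ there is a critical probability $p_c^{(d)}=p_c^{(d,n)}\in(0,1)$ such that for every $p\in(0,1)$: 1. if $p<p_c^{(d)}$, then $\dim_{tH}M^{(p,n)}\le d$ almost surely; 2. if $p>p_c^{(d)}$,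 then almost surely $M^{(p,n)}=\emptyset$ or $\dim_{tH}M^{(p,n)}>d$. Moreover, $p_c^{(0)}$ is a critical probability in the sense of the Chayes–Chayes–Durrett theorem: if $p<p_c^{(0)}$, then $M^{(p,n)}$ is totally disconnected almost surely, and if $p>p_c^{(0)}$, then $M^{(p,n)}$ has a connected component with more than one point with positive probability. -/

import Mathlib

open MeasureTheory ProbabilityTheory

/-- Hausdorff dimension of a subset of a metric space, with the convention that the empty set has
dimension `-1` (Mathlib's `dimH` gives it dimension `0`). -/
noncomputable def hausdorffDim {X : Type*} [MetricSpace X] (s : Set X) : EReal :=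
  open Classical in if s = ∅ then -1 else ((dimH s : ENNReal) : EReal)

/-- Topological Hausdorff dimension of a metric space `X`: it is `-1` if `X` is empty, and otherwise
the infimum of all `d` such that `X` has a basis of open sets whose boundaries have Hausdorff
dimension at most `d - 1`. The value `d = ∞` is allowed, with `∞ - 1 = ∞`. -/
noncomputable def topHausdorffDim (X : Type*) [MetricSpace X] : EReal :=
  open Classical in
  if IsEmpty X then -1
  else sInf {d : EReal | ∃ B : Set (Set X), TopologicalSpace.IsTopologicalBasis B ∧
    ∀ U ∈ B, hausdorffDim (frontier U) ≤ d - 1}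

namespace FractalPercolation

/-- The position of a sub-square in the `n × n` subdivision of a square: column `a 0`, row `a 1`. -/
abbrev Pos (n : ℕ) : Type := Fin 2 → Fin n

/-- The squares of level `k` are addressed by words of length `k`: the word `[a₁, …, a_k]` is the
sub-square at position `a_k` of the sub-square at position `a_(k-1)` of … of the sub-square at
position `a₁` of the unit square. This is its lower left corner, `∑ i, a_i / n ^ i`. -/
noncomputable def corner (n : ℕ) : List (Pos n) → Fin 2 → ℝ
  | [], _ => 0
  | a :: w, c => ((a c : ℝ) + corner n w c) / n

/-- The closed square of side length `1 / n ^ k` addressed by a word of length `k`. -/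
def square (n : ℕ) (w : List (Pos n)) : Set (EuclideanSpace ℝ (Fin 2)) :=
  {x | ∀ c, x c ∈ Set.Icc (corner n w c) (corner n w c + 1 / (n : ℝ) ^ w.length)}

/-- A choice is a set `K` of pairs `(u, a)`: the pair `(u, a)` lies in `K` if the sub-square at
position `a` of the square `u` is kept when `u` is subdivided. The square `w` is present after
`w.length` steps if it and all the squares of positive level that contain it in the construction
were kept. -/
def Retained {n : ℕ} (K : Set (List (Pos n) × Pos n)) (w : List (Pos n)) : Prop :=
  ∀ u a, (u ++ [a]) <+: w → (u, a) ∈ K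

/-- The set `M_k`: the union of the kept squares of level `k`. -/
def level {n : ℕ} (K : Set (List (Pos n) × Pos n)) (k : ℕ) : Set (EuclideanSpace ℝ (Fin 2)) :=
  ⋃ w ∈ {w : List (Pos n) | w.length = k ∧ Retained K w}, square n w

/-- The limit set `M`: the intersection of the sets `M_k`, `k ≥ 1`. -/
def limitSet {n : ℕ} (K : Set (List (Pos n) × Pos n)) : Set (EuclideanSpace ℝ (Fin 2)) :=
  ⋂ k ∈ Set.Ici 1, level K k

/-- Given the events `keep (u, a)` that the sub-square at position `a` of the square `u` is kept,
the random limit set. -/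
def randomLimitSet {n : ℕ} {Ω : Type*} (keep : List (Pos n) × Pos n → Set Ω) (ω : Ω) :
    Set (EuclideanSpace ℝ (Fin 2)) :=
  limitSet {q | ω ∈ keep q}

/-- Mandelbrot's fractal percolation with parameters `(p, n)`: every sub-square is kept with
probability `p`, and all these decisions are independent. -/
structure IsPercolation {n : ℕ} {Ω : Type*} [MeasurableSpace Ω] (P : Measure Ω) (p : ℝ)
    (keep : List (Pos n) × Pos n → Set Ω) : Prop where
  measurableSet : ∀ q, MeasurableSet (keep q)
  indep : iIndepSet keep P
  prob : ∀ q, P (keep q) = ENNReal.ofReal p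

end FractalPercolation

/-!
The argument replaces the topological Hausdorff dimension by a notion that is easier to handle on
compact sets. A set is called zero-dimensional modulo `s` (`IsZeroDimMod`) if countably many totally
disconnected compact sets cover it up to a set of vanishing `s`-dimensional Hausdorff measure.
A compact set has topological Hausdorff dimension at most `d` exactly if it is zero-dimensional
modulo every `s > d - 1`: countably many boundaries of basic open sets can be covered by small open
sets, off which the set is totally disconnected; conversely, two disjoint closed sets can be
separated by open sets that cover any given countable union of totally disconnected compact sets
(`exists_separation_of_iUnion`), so that separators may be taken inside the null set. For `s ≤ 0`
null sets are empty, and the notion becomes total disconnectedness, which gives the statement for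
`d = 0`.

Zero-dimensionality modulo `s` passes to subsets, similar images and countable unions, so the limit
set has it if and only if the limit sets seen from all kept squares of the first level have it.
It also amounts to being contained, for every `ε`, in one of certain open sets
(`isZeroDimMod_iff_forall_isFine`), and as the limit set depends upper semicontinuously on the
choices, it is a measurable event. Its probability is therefore a fixed point of the function
`x ↦ (1 - p * (1 - x)) ^ n ^ 2`, and so is the probability of extinction. By strict convexity there
is at most one fixed point below `1`; hence the dimension is almost surely at most `d`, or almost
surely larger than `d` on survival. Coupling all parameters by uniform labels makes the probability
monotone in `p`, and the critical probability is the supremum of the `p` where it equals `1`. It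
is positive because for `n ^ 2 * p < 1` the only fixed point is `1`.

That it is less than `1` needs a lower bound on the dimension for `p` close to `1`. Let
`max 0 (d - 1) < s < 1` and take `j` so large that `N = n ^ j` satisfies `2 * (1 + N ^ s) < N`. For
`p` close to `1`, with positive probability every square in a tree of good squares, in steps of `j`
levels, has at most one bad sub-square among its `N ^ 2` sub-squares (`BlockGood`). A separator
between the left and the right side with vanishing `s`-dimensional measure can be covered by squares
of total weight `< 1`; discarding every square whose share of the cover is too large removes fewer
than `N ^ s` further sub-squares from any square that is left (`card_overloaded_lt`). Fewer than
half of the rows and columns of each remaining square are then affected. The sub-squares in the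
unaffected rows and columns form connected sets, which match across common sides
(`exists_matching_points`), so that in the limit they meet any separator
(`exists_notMem_of_separation`), a contradiction.
-/

namespace FractalPercolation

open Set Filter Metric
open scoped Topology ENNReal NNReal

/-! ### Separation along totally disconnected compact sets -/

section ZeroDim

/-- Disjoint closed sets have disjoint open neighbourhoods covering a given totally disconnected
compact set, even with disjoint closures: distribute a clopen partition of the compact set over the
two closed sets before applying normality. -/
theorem exists_separation_of_isTotallyDisconnected {X : Type*} [TopologicalSpace X] [T4Space X]
    {A B K : Set X} (hA : IsClosed A) (hB : IsClosed B) (hAB : Disjoint A B) (hK : IsCompact K)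
    (hKt : IsTotallyDisconnected K) :
    ∃ U V : Set X, IsOpen U ∧ IsOpen V ∧ A ⊆ U ∧ B ⊆ V ∧ K ⊆ U ∪ V ∧
      Disjoint (closure U) (closure V) := by
  have : CompactSpace K := isCompact_iff_compactSpace.1 hK
  have : TotallyDisconnectedSpace K := totallyDisconnectedSpace_subtype_iff.2 hKt
  obtain ⟨C, hC, hAC, hCB⟩ := exists_clopen_of_closed_subset_open
    (Z := ((↑) : K → X) ⁻¹' A) (U := ((↑) : K → X) ⁻¹' Bᶜ)
    (hA.preimage continuous_subtype_val) (hB.isOpen_compl.preimage continuous_subtype_val)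
    (preimage_mono hAB.subset_compl_right)
  have hcl : ∀ D : Set K, IsClosed D → IsClosed (((↑) : K → X) '' D) := fun D hD =>
    hK.isClosed.isClosedEmbedding_subtypeVal.isClosedMap D hD
  have hdisj : Disjoint (A ∪ (↑) '' C) (B ∪ (↑) '' Cᶜ) := by
    rw [Set.disjoint_left]
    rintro x (hx | ⟨x, hx, rfl⟩) (hy | ⟨y, hy, hxy⟩)
    · exact hAB.ne_of_mem hx hy rfl
    · exact hy (hAC (by subst hxy; exact hx))
    · exact hCB hx hy
    · exact hy (Subtype.ext hxy ▸ hx)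
  have h1 := hA.union (hcl C hC.isClosed)
  have h2 := hB.union (hcl Cᶜ hC.compl.isClosed)
  obtain ⟨U, hU, hAU, hUB⟩ := normal_exists_closure_subset h1 h2.isOpen_compl
    hdisj.subset_compl_right
  obtain ⟨V, hV, hBV, hVU⟩ := normal_exists_closure_subset h2 isClosed_closure.isOpen_compl
    (subset_compl_comm.1 hUB)
  refine ⟨U, V, hU, hV, subset_union_left.trans hAU, subset_union_left.trans hBV, fun x hx => ?_,
    (disjoint_left.2 fun x hx hy => hVU hy hx)⟩
  by_cases h : (⟨x, hx⟩ : K) ∈ C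
  · exact Or.inl (hAU (Or.inr ⟨_, h, rfl⟩))
  · exact Or.inr (hBV (Or.inr ⟨_, h, rfl⟩))

/-- Disjoint closed sets can be separated by disjoint open sets which together cover any given
countable union of totally disconnected compact sets. -/
theorem exists_separation_of_iUnion {X : Type*} [TopologicalSpace X] [T4Space X]
    {A B : Set X} {K : ℕ → Set X} (hA : IsClosed A) (hB : IsClosed B) (hAB : Disjoint A B)
    (hK : ∀ j, IsCompact (K j)) (hKt : ∀ j, IsTotallyDisconnected (K j)) :
    ∃ U V : Set X, IsOpen U ∧ IsOpen V ∧ A ⊆ U ∧ B ⊆ V ∧ (⋃ j, K j) ⊆ U ∪ V ∧ Disjoint U V := by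
  let T := {p : Set X × Set X // Disjoint (closure p.1) (closure p.2)}
  have step : ∀ (j : ℕ) (p : T), ∃ q : T, IsOpen q.1.1 ∧ IsOpen q.1.2 ∧ closure p.1.1 ⊆ q.1.1 ∧
      closure p.1.2 ⊆ q.1.2 ∧ K j ⊆ q.1.1 ∪ q.1.2 := by
    intro j p
    obtain ⟨U, V, h1, h2, h3, h4, h5, h6⟩ := exists_separation_of_isTotallyDisconnected
      isClosed_closure isClosed_closure p.2 (hK j) (hKt j)
    exact ⟨⟨(U, V), h6⟩, h1, h2, h3, h4, h5⟩
  choose f h1 h2 h3 h4 h5 using step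
  let p : ℕ → T := fun j => Nat.rec ⟨(A, B), by rwa [hA.closure_eq, hB.closure_eq]⟩ f j
  have hp : ∀ j, p (j + 1) = f j (p j) := fun _ => rfl
  have hm1 : Monotone fun j => (p j).1.1 := monotone_nat_of_le_succ fun j =>
    subset_closure.trans (h3 j (p j))
  have hm2 : Monotone fun j => (p j).1.2 := monotone_nat_of_le_succ fun j =>
    subset_closure.trans (h4 j (p j))
  refine ⟨⋃ j, (p (j + 1)).1.1, ⋃ j, (p (j + 1)).1.2, isOpen_iUnion fun j => h1 j (p j),
    isOpen_iUnion fun j => h2 j (p j), ?_, ?_, ?_, ?_⟩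
  · exact (hm1 zero_le_one).trans (subset_iUnion (fun j => (p (j + 1)).1.1) 0)
  · exact (hm2 zero_le_one).trans (subset_iUnion (fun j => (p (j + 1)).1.2) 0)
  · refine iUnion_subset fun j x hx => ?_
    rcases h5 j (p j) hx with h | h
    · exact Or.inl (mem_iUnion.2 ⟨j, h⟩)
    · exact Or.inr (mem_iUnion.2 ⟨j, h⟩)
  · simp only [disjoint_iUnion_left, disjoint_iUnion_right]
    intro i j
    have h := (p (max i j + 1)).2
    refine h.mono ?_ ?_
    · exact (hm1 (Nat.succ_le_succ (le_max_right i j))).trans subset_closure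
    · exact (hm2 (Nat.succ_le_succ (le_max_left i j))).trans subset_closure

/-- A countable union of totally disconnected compact sets is totally disconnected. -/
theorem isTotallyDisconnected_of_subset_iUnion {X : Type*} [TopologicalSpace X] [T4Space X]
    {M : Set X} {K : ℕ → Set X} (hK : ∀ j, IsCompact (K j))
    (hKt : ∀ j, IsTotallyDisconnected (K j)) (hM : M ⊆ ⋃ j, K j) : IsTotallyDisconnected M := by
  intro t htM ht x hx y hy
  by_contra hxy
  obtain ⟨U, V, hU, hV, hxU, hyV, hUV, hd⟩ := exists_separation_of_iUnion
    (isClosed_singleton (x := x)) (isClosed_singleton (x := y)) (by simpa using hxy) hK hKt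
  obtain ⟨z, -, hz⟩ := ht U V hU hV ((htM.trans hM).trans hUV)
    ⟨x, hx, hxU rfl⟩ ⟨y, hy, hyV rfl⟩
  exact hd.ne_of_mem hz.1 hz.2 rfl

end ZeroDim

/-! ### Small sets and sets of vanishing Hausdorff measure -/

section SmallSets

variable {X : Type*} [MetricSpace X]

/-- A set is `(s, ε)`-small if it is a union of countably many open sets of diameter at most `ε`
whose `s`-dimensional weights sum to at most `ε`. Empty pieces have weight zero, also for `s ≤ 0`,
as in the definition of Hausdorff measure. -/
def IsSmall (s : ℝ) (ε : ℝ≥0∞) (W : Set X) : Prop :=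
  ∃ A : ℕ → Set X, (∀ i, IsOpen (A i)) ∧ (∀ i, ediam (A i) ≤ ε) ∧ W = ⋃ i, A i ∧
    ∑' i, ⨆ _ : (A i).Nonempty, ediam (A i) ^ s ≤ ε

theorem IsSmall.isOpen {s : ℝ} {ε : ℝ≥0∞} {W : Set X} (h : IsSmall s ε W) : IsOpen W := by
  obtain ⟨A, hA, -, rfl, -⟩ := h
  exact isOpen_iUnion hA

theorem IsSmall.mono {s : ℝ} {ε δ : ℝ≥0∞} {W : Set X} (h : IsSmall s ε W) (hδ : ε ≤ δ) :
    IsSmall s δ W := by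
  obtain ⟨A, h1, h2, h3, h4⟩ := h
  exact ⟨A, h1, fun i => (h2 i).trans hδ, h3, h4.trans hδ⟩

theorem IsSmall.iUnion {s : ℝ} {ε : ℕ → ℝ≥0∞} {W : ℕ → Set X} (h : ∀ m, IsSmall s (ε m) (W m)) :
    IsSmall s (∑' m, ε m) (⋃ m, W m) := by
  choose A h1 h2 h3 h4 using h
  refine ⟨fun i => A i.unpair.1 i.unpair.2, fun i => h1 _ _,
    fun i => (h2 _ _).trans (ENNReal.le_tsum _), ?_, ?_⟩
  · rw [Set.iUnion_unpair]
    simp_rw [h3]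
  · have := Nat.pairEquiv.symm.tsum_eq
      (fun p : ℕ × ℕ => ⨆ _ : (A p.1 p.2).Nonempty, ediam (A p.1 p.2) ^ s)
    simp only [Nat.pairEquiv_symm_apply] at this
    rw [this, ENNReal.tsum_prod (f := fun m i => ⨆ _ : (A m i).Nonempty, ediam (A m i) ^ s)]
    exact ENNReal.tsum_le_tsum h4

/-- The open sets obtained as the union of an `(s, ε)`-small set and disjoint open sets of diameter
at most `ε`. A compact set is zero-dimensional modulo `s` if and only if it is contained in such a
set for every `ε > 0`. -/
def IsFine (s : ℝ) (ε : ℝ≥0∞) (O : Set X) : Prop :=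
  ∃ (W : Set X) (D : ℕ → Set X), IsSmall s ε W ∧ (∀ i, IsOpen (D i)) ∧ (∀ i, ediam (D i) ≤ ε) ∧
    Pairwise (Function.onFun Disjoint D) ∧ O = W ∪ ⋃ i, D i

theorem IsFine.isOpen {s : ℝ} {ε : ℝ≥0∞} {O : Set X} (h : IsFine s ε O) : IsOpen O := by
  obtain ⟨W, D, h1, h2, -, -, rfl⟩ := h
  exact h1.isOpen.union (isOpen_iUnion h2)

variable [MeasurableSpace X] [BorelSpace X]

theorem eq_empty_of_hausdorffMeasure_eq_zero {s : ℝ} (hs : s ≤ 0) {N : Set X} (h : μH[s] N = 0) :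
    N = ∅ := by
  by_contra hN
  have h1 := Measure.one_le_hausdorffMeasure_zero_of_nonempty (nonempty_iff_ne_empty.2 hN)
  have h2 := Measure.hausdorffMeasure_mono hs N
  simp [h] at h2
  simp [h2] at h1

theorem hausdorffMeasure_eq_zero_of_isSmall {s : ℝ} {N : Set X}
    (h : ∀ ε : ℝ≥0∞, 0 < ε → ∃ W, N ⊆ W ∧ IsSmall s ε W) : μH[s] N = 0 := by
  rw [Measure.hausdorffMeasure_apply]
  simp only [ENNReal.iSup_eq_zero]
  intro r hr
  rw [← nonpos_iff_eq_zero]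
  refine le_of_forall_gt_imp_ge_of_dense fun δ hδ => ?_
  obtain ⟨W, hNW, A, h1, h2, rfl, h4⟩ := h (min r δ) (lt_min hr hδ)
  refine (iInf_le_of_le A (iInf_le_of_le hNW (iInf_le_of_le (fun n => (h2 n).trans
    (min_le_left _ _)) (h4.trans (min_le_right _ _)))))

/-- Null sets of the Hausdorff measure have small open neighbourhoods. -/
theorem exists_isSmall_of_hausdorffMeasure_eq_zero {s : ℝ} {N : Set X} (h : μH[s] N = 0)
    {ε : ℝ≥0∞} (hε : 0 < ε) : ∃ W, N ⊆ W ∧ IsSmall s ε W := by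
  rcases le_or_gt s 0 with hs | hs
  · obtain rfl := eq_empty_of_hausdorffMeasure_eq_zero hs h
    exact ⟨∅, subset_rfl, fun _ => ∅, by simp, by simp, by simp, by simp⟩
  wlog hε1 : ε ≤ 1 generalizing ε
  · obtain ⟨W, h1, h2⟩ := this (ε := 1) one_pos le_rfl
    exact ⟨W, h1, h2.mono (not_le.1 hε1).le⟩
  obtain ⟨r, hr0, hr⟩ : ∃ r : ℝ≥0∞, 0 < r ∧ r < ε := exists_between hε
  obtain ⟨ε', hε', hsum⟩ := ENNReal.exists_pos_sum_of_countable' (tsub_pos_of_lt hr).ne' ℕ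
  have h0 : ⨅ (t : ℕ → Set X) (_ : N ⊆ ⋃ n, t n) (_ : ∀ n, ediam (t n) ≤ r),
      ∑' n, ⨆ _ : (t n).Nonempty, ediam (t n) ^ s < r := by
    refine lt_of_le_of_lt ?_ hr0
    rw [← h, Measure.hausdorffMeasure_apply]
    exact le_iSup₂_of_le r hr0 le_rfl
  simp only [iInf_lt_iff] at h0
  obtain ⟨t, ht1, ht2, ht3⟩ := h0
  -- each piece is replaced by a thin open neighbourhood of slightly larger weight
  have hfat : ∀ i, ∃ δ : ℝ≥0, 0 < δ ∧ ediam (t i) + 2 * δ ≤ ε ∧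
      (ediam (t i) + 2 * δ) ^ s ≤ ediam (t i) ^ s + ε' i := by
    intro i
    have hfin : ediam (t i) ≠ ∞ := ((ht2 i).trans_lt (hr.trans_le (le_top))).ne
    have hc : Tendsto (fun δ : ℝ≥0 => ediam (t i) + 2 * (δ : ℝ≥0∞)) (𝓝[>] 0)
        (𝓝 (ediam (t i))) := by
      have : Continuous fun δ : ℝ≥0 => ediam (t i) + 2 * (δ : ℝ≥0∞) := by
        refine continuous_const.add ?_
        exact (ENNReal.continuous_const_mul (by simp)).comp ENNReal.continuous_coe
      have h2 := this.tendsto 0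
      simp only [ENNReal.coe_zero, mul_zero, add_zero] at h2
      exact h2.mono_left nhdsWithin_le_nhds
    have hc' := (ENNReal.continuous_rpow_const (y := s)).tendsto (ediam (t i)) |>.comp hc
    have e1 : ∀ᶠ δ : ℝ≥0 in 𝓝[>] 0, ediam (t i) + 2 * (δ : ℝ≥0∞) < ε :=
      hc.eventually_lt_const ((ht2 i).trans_lt hr)
    have e2 : ∀ᶠ δ : ℝ≥0 in 𝓝[>] 0,
        (ediam (t i) + 2 * (δ : ℝ≥0∞)) ^ s < ediam (t i) ^ s + ε' i :=
      hc'.eventually_lt_const (ENNReal.lt_add_right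
        (ENNReal.rpow_ne_top_of_nonneg hs.le hfin) (hε' i).ne')
    obtain ⟨δ, ⟨h1, h2⟩, h3⟩ := ((e1.and e2).and self_mem_nhdsWithin).exists
    exact ⟨δ, h3, h1.le, h2.le⟩
  choose δ hδ0 hδ1 hδ2 using hfat
  refine ⟨⋃ i, thickening (δ i) (t i), ht1.trans (iUnion_mono fun i =>
    self_subset_thickening (by exact_mod_cast hδ0 i) _), fun i => thickening (δ i) (t i),
    fun i => isOpen_thickening, fun i => (ediam_thickening_le _).trans (hδ1 i), rfl, ?_⟩
  calc ∑' i, ⨆ _ : (thickening (δ i) (t i)).Nonempty, ediam (thickening (δ i) (t i)) ^ s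
      ≤ ∑' i, ((⨆ _ : (t i).Nonempty, ediam (t i) ^ s) + ε' i) := by
        refine ENNReal.tsum_le_tsum fun i => iSup_le fun hne => ?_
        have : (t i).Nonempty := by
          by_contra hn
          rw [not_nonempty_iff_eq_empty.1 hn, thickening_empty] at hne
          exact hne.ne_empty rfl
        simp only [this, iSup_pos]
        exact (ENNReal.rpow_le_rpow (ediam_thickening_le _) hs.le).trans (hδ2 i)
    _ ≤ r + (ε - r) := by
        rw [ENNReal.tsum_add]
        exact add_le_add ht3.le hsum.le
    _ = ε := add_tsub_cancel_of_le hr.le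

end SmallSets

/-! ### Zero-dimensionality modulo null sets -/

section ZeroDimModNull

variable {X : Type*} [MetricSpace X] [MeasurableSpace X] [BorelSpace X]

/-- A set is zero-dimensional modulo `s` if countably many totally disconnected compact sets cover
it up to a set of vanishing `s`-dimensional Hausdorff measure. For `s ≤ 0` only the empty set has
measure zero. -/
def IsZeroDimMod (s : ℝ) (M : Set X) : Prop :=
  ∃ K : ℕ → Set X, (∀ j, IsCompact (K j)) ∧ (∀ j, IsTotallyDisconnected (K j)) ∧
    μH[s] (M \ ⋃ j, K j) = 0

theorem IsZeroDimMod.mono {s : ℝ} {M N : Set X} (h : IsZeroDimMod s M) (hN : N ⊆ M) :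
    IsZeroDimMod s N := by
  obtain ⟨K, h1, h2, h3⟩ := h
  exact ⟨K, h1, h2, measure_mono_null (sdiff_subset_sdiff_left hN) h3⟩

theorem IsZeroDimMod.mono_dim {s t : ℝ} {M : Set X} (h : IsZeroDimMod s M) (hst : s ≤ t) :
    IsZeroDimMod t M := by
  obtain ⟨K, h1, h2, h3⟩ := h
  exact ⟨K, h1, h2, nonpos_iff_eq_zero.1 (h3 ▸ Measure.hausdorffMeasure_mono hst _)⟩

theorem IsZeroDimMod.of_isTotallyDisconnected (s : ℝ) {M : Set X} (hM : IsCompact M)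
    (h : IsTotallyDisconnected M) : IsZeroDimMod s M :=
  ⟨fun _ => M, fun _ => hM, fun _ => h, by simp [iUnion_const]⟩

theorem isZeroDimMod_empty (s : ℝ) : IsZeroDimMod s (∅ : Set X) :=
  .of_isTotallyDisconnected s isCompact_empty isTotallyDisconnected_empty

theorem IsZeroDimMod.isTotallyDisconnected {s : ℝ} (hs : s ≤ 0) {M : Set X}
    (h : IsZeroDimMod s M) : IsTotallyDisconnected M := by
  obtain ⟨K, h1, h2, h3⟩ := h
  exact isTotallyDisconnected_of_subset_iUnion h1 h2
    (sdiff_eq_empty.1 (eq_empty_of_hausdorffMeasure_eq_zero hs h3))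

theorem IsZeroDimMod.iUnion {s : ℝ} {ι : Type*} [Countable ι] {M : ι → Set X}
    (h : ∀ i, IsZeroDimMod s (M i)) : IsZeroDimMod s (⋃ i, M i) := by
  rcases isEmpty_or_nonempty ι with hι | hι
  · simpa using isZeroDimMod_empty s
  choose K h1 h2 h3 using h
  obtain ⟨f, hf⟩ := exists_surjective_nat (ι × ℕ)
  refine ⟨fun j => K (f j).1 (f j).2, fun _ => h1 _ _, fun _ => h2 _ _, ?_⟩
  refine measure_mono_null ?_ (measure_iUnion_null h3)
  rintro x ⟨hx, hxK⟩
  obtain ⟨i, hi⟩ := mem_iUnion.1 hx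
  refine mem_iUnion.2 ⟨i, hi, fun hx' => hxK ?_⟩
  obtain ⟨j, hj⟩ := mem_iUnion.1 hx'
  obtain ⟨m, hm⟩ := hf (i, j)
  exact mem_iUnion.2 ⟨m, by simpa [hm] using hj⟩

theorem IsZeroDimMod.image {Y : Type*} [MetricSpace Y] [MeasurableSpace Y] [BorelSpace Y] {s : ℝ}
    {M : Set X} (h : IsZeroDimMod s M) (f : X ≃ₜ Y) {C : ℝ≥0} (hf : LipschitzWith C f) :
    IsZeroDimMod s (f '' M) := by
  obtain ⟨K, h1, h2, h3⟩ := h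
  refine ⟨fun j => f '' K j, fun j => (h1 j).image f.continuous,
    fun j => f.isEmbedding.isTotallyDisconnected_image.2 (h2 j), ?_⟩
  rw [← image_iUnion, ← image_sdiff f.injective]
  rcases lt_or_ge s 0 with hs | hs
  · rw [eq_empty_of_hausdorffMeasure_eq_zero hs.le h3, image_empty, measure_empty]
  · have := hf.hausdorffMeasure_image_le hs (M \ ⋃ j, K j)
    rw [h3, mul_zero] at this
    exact nonpos_iff_eq_zero.1 this

/-- If a compact set becomes totally disconnected by removing any tail of a sequence of small open
sets `W m`, then it is zero-dimensional modulo `s`: the points in infinitely many `W m` form a null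
set. -/
theorem isZeroDimMod_of_isSmall {s : ℝ} {M : Set X} (hM : IsCompact M) {W : ℕ → Set X}
    (hW : ∀ m, IsSmall s ((2 : ℝ≥0∞)⁻¹ ^ m) (W m))
    (ht : ∀ j, IsTotallyDisconnected (M \ ⋃ m, W (m + j))) : IsZeroDimMod s M := by
  refine ⟨fun j => M \ ⋃ m, W (m + j), fun j => hM.diff (isOpen_iUnion fun m => (hW _).isOpen), ht,
    hausdorffMeasure_eq_zero_of_isSmall fun ε hε => ?_⟩
  have hlim : Tendsto (fun j : ℕ => ∑' m, (2 : ℝ≥0∞)⁻¹ ^ (m + j)) atTop (𝓝 0) :=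
    ENNReal.tendsto_sum_nat_add _ (by simp [ENNReal.tsum_geometric])
  obtain ⟨j, hj⟩ := (hlim.eventually_lt_const hε).exists
  refine ⟨⋃ m, W (m + j), ?_, (IsSmall.iUnion fun m => hW (m + j)).mono hj.le⟩
  rintro x ⟨hx, hx'⟩
  by_contra hxW
  exact hx' (mem_iUnion.2 ⟨j, hx, hxW⟩)

theorem IsZeroDimMod.exists_isFine [SecondCountableTopology X] {s : ℝ} {M : Set X}
    (h : IsZeroDimMod s M) {ε : ℝ≥0∞} (hε : 0 < ε) :
    ∃ O, IsFine s ε O ∧ M ⊆ O := by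
  obtain ⟨K, h1, h2, h3⟩ := h
  obtain ⟨W, hNW, hW⟩ := exists_isSmall_of_hausdorffMeasure_eq_zero h3 hε
  have hsep : ∀ x : X, ∃ U V : Set X, IsOpen U ∧ IsOpen V ∧ x ∈ U ∧ ediam U ≤ ε ∧
      (⋃ j, K j) ⊆ U ∪ V ∧ Disjoint U V := by
    intro x
    have hε2 : 0 < ε / 2 := ENNReal.half_pos hε.ne'
    obtain ⟨U, V, hU, hV, hxU, hBV, hUV, hd⟩ := exists_separation_of_iUnion
      (A := {x}) (B := (eball x (ε / 2))ᶜ) isClosed_singleton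
      isOpen_eball.isClosed_compl (by simpa using hε.ne') h1 h2
    refine ⟨U, V, hU, hV, hxU rfl, ?_, hUV, hd⟩
    have : U ⊆ eball x (ε / 2) := fun y hy => by
      by_contra hyB
      exact hd.ne_of_mem hy (hBV hyB) rfl
    calc ediam U ≤ ediam (eball x (ε / 2)) := ediam_mono this
      _ ≤ 2 * (ε / 2) := ediam_eball_le
      _ = ε := ENNReal.mul_div_cancel (by simp) (by simp)
  choose U V hU hV hxU hUε hUV hd using hsep
  obtain ⟨T, hT, hTU⟩ := TopologicalSpace.countable_cover_nhds
    fun x => (hU x).mem_nhds (hxU x)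
  rcases isEmpty_or_nonempty X with hX | hX
  · exact ⟨W ∪ ⋃ _ : ℕ, ∅, ⟨W, fun _ => ∅, hW, by simp, by simp, by intro; simp, rfl⟩,
      fun x => (hX.false x).elim⟩
  have hTne : T.Nonempty := by
    obtain ⟨x⟩ := hX
    have : x ∈ ⋃ y ∈ T, U y := hTU ▸ mem_univ x
    simp only [mem_iUnion] at this
    exact ⟨_, this.choose_spec.choose⟩
  obtain ⟨e, rfl⟩ := hT.exists_eq_range hTne
  let D : ℕ → Set X := fun i => U (e i) ∩ ⋂ l ∈ Finset.range i, V (e l)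
  refine ⟨W ∪ ⋃ i, D i, ⟨W, D, hW, fun i => (hU _).inter
    (isOpen_biInter_finset fun l _ => hV _),
    fun i => (ediam_mono inter_subset_left).trans (hUε _), ?_, rfl⟩, fun x hx => ?_⟩
  · have key : ∀ i j, i < j → Disjoint (D i) (D j) := fun i j hij =>
      (hd (e i)).mono inter_subset_left
        (inter_subset_right.trans (biInter_subset_of_mem (by simpa using hij)))
    intro i j hij
    rcases hij.lt_or_gt with h | h
    · exact key i j h
    · exact (key j i h).symm
  · by_cases hxW : x ∈ W
    · exact Or.inl hxW
    right
    have hxK : x ∈ ⋃ j, K j := by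
      by_contra hxK
      exact hxW (hNW ⟨hx, hxK⟩)
    classical
    have hex : ∃ i, x ∈ U (e i) := by
      have : x ∈ ⋃ y ∈ range e, U y := hTU ▸ mem_univ x
      simpa using this
    refine mem_iUnion.2 ⟨Nat.find hex, Nat.find_spec hex, mem_iInter₂.2 fun l hl => ?_⟩
    exact (hUV _ hxK).resolve_left (Nat.find_min hex (by simpa using hl))

theorem isZeroDimMod_iff_forall_isFine [SecondCountableTopology X] {s : ℝ} {M : Set X}
    (hM : IsCompact M) :
    IsZeroDimMod s M ↔ ∀ m : ℕ, ∃ O, IsFine s ((2 : ℝ≥0∞)⁻¹ ^ m) O ∧ M ⊆ O := by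
  refine ⟨fun h m => h.exists_isFine (ENNReal.pow_pos (by simp) m), fun h => ?_⟩
  choose O hO hMO using h
  choose W D hW hD hDε hdisj hOe using hO
  refine isZeroDimMod_of_isSmall hM hW fun j t ht htp x hx y hy => ?_
  rw [← edist_eq_zero, ← nonpos_iff_eq_zero]
  have hlim : Tendsto (fun m : ℕ => (2 : ℝ≥0∞)⁻¹ ^ m) atTop (𝓝 0) :=
    ENNReal.tendsto_pow_atTop_nhds_zero_of_lt_one (by simp)
  refine ge_of_tendsto hlim (eventually_atTop.2 ⟨j, fun m hm => ?_⟩)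
  -- the connected set `t` avoids `W m`, hence lies in a single one of the disjoint sets `D m i`
  have hsub : t ⊆ ⋃ i, D m i := fun z hz => by
    have h1 := ht hz
    have h2 : z ∈ W m ∪ ⋃ i, D m i := hOe m ▸ hMO m h1.1
    refine h2.resolve_left fun h3 => h1.2 (mem_iUnion.2 ⟨m - j, ?_⟩)
    rwa [Nat.sub_add_cancel hm]
  obtain ⟨i, hi⟩ := mem_iUnion.1 (hsub hx)
  have hti : t ⊆ D m i := by
    refine htp.subset_left_of_subset_union (v := ⋃ l ∈ {l | l ≠ i}, D m l) (hD m i)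
      (isOpen_biUnion fun l _ => hD m l) ?_ ?_ ⟨x, hx, hi⟩
    · simp only [disjoint_iUnion_right]
      exact fun l hl => hdisj m (Ne.symm hl)
    · intro z hz
      obtain ⟨l, hl⟩ := mem_iUnion.1 (hsub hz)
      by_cases hli : l = i
      · exact Or.inl (hli ▸ hl)
      · exact Or.inr (mem_biUnion (show l ∈ {l | l ≠ i} from hli) hl)
  exact (edist_le_ediam_of_mem hi (hti hy)).trans (hDε m i)

end ZeroDimModNull

/-! ### The topological Hausdorff dimension of compact sets -/

section TopHausdorffDim

variable {X : Type*} [MetricSpace X] [MeasurableSpace X] [BorelSpace X]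

theorem hausdorffMeasure_eq_zero_of_hausdorffDim_lt {s : ℝ} {N : Set X}
    (h : hausdorffDim N < (s : EReal)) : μH[s] N = 0 := by
  rcases eq_empty_or_nonempty N with rfl | hN
  · simp
  rw [hausdorffDim, if_neg hN.ne_empty] at h
  have hs : 0 ≤ s := by
    have : (0 : EReal) ≤ ((dimH N : ℝ≥0∞) : EReal) := EReal.coe_ennreal_nonneg _
    exact_mod_cast (this.trans h.le)
  lift s to ℝ≥0 using hs
  refine hausdorffMeasure_of_dimH_lt ?_
  have h2 : ((s : ℝ) : EReal) = ((s : ℝ≥0∞) : EReal) := rfl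
  rw [h2, EReal.coe_ennreal_lt_coe_ennreal_iff] at h
  exact h

theorem hausdorffDim_le_of_hausdorffMeasure_eq_zero {s : ℝ} (hs : -1 ≤ s) {N : Set X}
    (h : μH[s] N = 0) : hausdorffDim N ≤ (s : EReal) := by
  rw [hausdorffDim]
  split_ifs with hN
  · rw [← EReal.coe_one, ← EReal.coe_neg]
    exact EReal.coe_le_coe_iff.2 hs
  have hs0 : 0 ≤ s := by
    by_contra hlt
    exact hN (eq_empty_of_hausdorffMeasure_eq_zero (not_le.1 hlt).le h)
  lift s to ℝ≥0 using hs0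
  have h1 : dimH N ≤ s := dimH_le_of_hausdorffMeasure_ne_top (by simp [h])
  have h2 : ((s : ℝ) : EReal) = ((s : ℝ≥0∞) : EReal) := rfl
  rw [h2]
  exact EReal.coe_ennreal_le_coe_ennreal_iff.2 h1

/-- Being zero-dimensional modulo every `s > d - 1` bounds the topological Hausdorff dimension by
`d`: a point and a closed set not containing it can be separated along a null set. -/
theorem topHausdorffDim_le_of_isZeroDimMod {M : Set X} (hM : IsCompact M) {d : ℝ} (hd : 0 ≤ d)
    (h : ∀ s : ℝ, d - 1 < s → IsZeroDimMod s M) : topHausdorffDim M ≤ (d : EReal) := by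
  rw [topHausdorffDim]
  split_ifs with hE
  · rw [← EReal.coe_one, ← EReal.coe_neg]
    exact EReal.coe_le_coe_iff.2 (by linarith)
  rw [← EReal.le_of_forall_lt_iff_le]
  intro z hz
  have hz' : d < z := by exact_mod_cast hz
  obtain ⟨K, hK1, hK2, hK3⟩ := h (z - 1) (by linarith)
  refine sInf_le ⟨{U | IsOpen U ∧ hausdorffDim (frontier U) ≤ (z : EReal) - 1}, ?_,
    fun U hU => hU.2⟩
  refine TopologicalSpace.isTopologicalBasis_of_isOpen_of_nhds (fun U hU => hU.1) ?_
  intro x O hxO hO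
  have hcl : IsClosed (((↑) : M → X) '' Oᶜ) :=
    hM.isClosed.isClosedEmbedding_subtypeVal.isClosedMap _ hO.isClosed_compl
  obtain ⟨U, V, hU, hV, hxU, hQV, hKUV, hd⟩ := exists_separation_of_iUnion
    (A := {(x : X)}) isClosed_singleton hcl (by simpa using hxO) hK1 hK2
  refine ⟨(↑) ⁻¹' U, ⟨hU.preimage continuous_subtype_val, ?_⟩, hxU rfl, fun y hy => ?_⟩
  · have hsub : ((↑) : M → X) '' frontier (((↑) : M → X) ⁻¹' U) ⊆ M \ ⋃ j, K j := by
      rintro _ ⟨y, hy, rfl⟩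
      refine ⟨y.2, fun hyK => ?_⟩
      rw [(hU.preimage continuous_subtype_val).frontier_eq] at hy
      rcases hKUV hyK with hyU | hyV
      · exact hy.2 hyU
      · obtain ⟨w, hw1, hw2⟩ := mem_closure_iff.1 hy.1 _ (hV.preimage continuous_subtype_val) hyV
        exact hd.ne_of_mem hw2 hw1 rfl
    have h0 : μH[z - 1] (frontier (((↑) : M → X) ⁻¹' U)) = 0 := by
      rcases lt_or_ge (z - 1) 0 with hz0 | hz0
      · have := eq_empty_of_hausdorffMeasure_eq_zero hz0.le (measure_mono_null hsub hK3)
        rw [image_eq_empty] at this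
        simp [this]
      · rw [← isometry_subtype_coe.hausdorffMeasure_image (Or.inl hz0)]
        exact measure_mono_null hsub hK3
    have := hausdorffDim_le_of_hausdorffMeasure_eq_zero (by linarith) h0
    rwa [EReal.coe_sub, EReal.coe_one] at this
  · by_contra hyO
    exact hd.ne_of_mem hy (hQV ⟨y, hyO, rfl⟩) rfl

theorem isZeroDimMod_of_topHausdorffDim_le [SecondCountableTopology X] {M : Set X}
    (hM : IsCompact M) {d s : ℝ} (h : topHausdorffDim M ≤ (d : EReal)) (hs : d - 1 < s) :
    IsZeroDimMod s M := by
  rw [topHausdorffDim] at h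
  split_ifs at h with hE
  · rw [isEmpty_coe_sort] at hE
    exact hE ▸ isZeroDimMod_empty s
  have hlt : (d : EReal) < ((s + 1 : ℝ) : EReal) := by
    exact_mod_cast (by linarith : d < s + 1)
  obtain ⟨d', ⟨B, hB, hBd⟩, hd'⟩ := sInf_lt_iff.1 (h.trans_lt hlt)
  obtain ⟨B', hB'B, hB'c, hB'⟩ := hB.exists_countable
  have hd's : d' - 1 < (s : EReal) := by
    rw [← EReal.coe_one, EReal.sub_lt_iff (Or.inl (EReal.coe_ne_bot 1))
      (Or.inl (EReal.coe_ne_top 1))]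
    exact_mod_cast hd'
  have hnull : ∀ U ∈ B', μH[s] (((↑) : M → X) '' frontier U) = 0 := by
    intro U hU
    have h0 := hausdorffMeasure_eq_zero_of_hausdorffDim_lt ((hBd U (hB'B hU)).trans_lt hd's)
    rcases lt_or_ge s 0 with hs0 | hs0
    · simp [eq_empty_of_hausdorffMeasure_eq_zero hs0.le h0]
    · rwa [isometry_subtype_coe.hausdorffMeasure_image (Or.inl hs0)]
  have hnull' : μH[s] (⋃ U ∈ B', ((↑) : M → X) '' frontier U) = 0 :=
    (measure_biUnion_null_iff hB'c).2 hnull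
  have hW := fun m : ℕ => exists_isSmall_of_hausdorffMeasure_eq_zero hnull'
    (ε := (2 : ℝ≥0∞)⁻¹ ^ m) (ENNReal.pow_pos (by simp) m)
  choose W hNW hW using hW
  refine isZeroDimMod_of_isSmall hM hW fun j t ht htp x hx y hy => ?_
  -- basic open sets are relatively clopen off the union of their boundaries
  by_contra hxy
  have htM : t ⊆ M := fun z hz => (ht hz).1
  obtain ⟨U, hUB, hxU, hUy⟩ := hB'.exists_subset_of_mem_open
    (show (⟨x, htM hx⟩ : M) ∈ ({⟨y, htM hy⟩}ᶜ : Set M) by simpa using hxy) isOpen_compl_singleton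
  have hU := hB'.isOpen hUB
  have hpre : IsPreconnected (((↑) : M → X) ⁻¹' t) := by
    rw [← Topology.IsInducing.subtypeVal.isPreconnected_image, Subtype.image_preimage_coe,
      inter_eq_right.2 htM]
    exact htp
  have hcov : ((↑) : M → X) ⁻¹' t ⊆ U ∪ (closure U)ᶜ := by
    intro z hz
    by_cases hzU : z ∈ U
    · exact Or.inl hzU
    · refine Or.inr fun hzc => (ht hz).2 (mem_iUnion.2 ⟨0, hNW _ (mem_biUnion hUB ⟨z, ?_, rfl⟩)⟩)
      rw [hU.frontier_eq]
      exact ⟨hzc, hzU⟩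
  have := hpre.subset_left_of_subset_union hU isClosed_closure.isOpen_compl
    (disjoint_compl_right_iff_subset.2 subset_closure) hcov ⟨⟨x, htM hx⟩, hx, hxU⟩
    (show (⟨y, htM hy⟩ : M) ∈ _ from hy)
  exact hUy this rfl

end TopHausdorffDim

/-! ### Self-similarity and compactness of the limit set -/

section LimitSet

variable {n : ℕ}

/-- The choices seen from the square `w`, as a choice for the unit square. -/
def shift (K : Set (List (Pos n) × Pos n)) (w : List (Pos n)) : Set (List (Pos n) × Pos n) :=
  {q | (w ++ q.1, q.2) ∈ K}

theorem shift_nil (K : Set (List (Pos n) × Pos n)) : shift K [] = K := rfl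

theorem shift_append (K : Set (List (Pos n) × Pos n)) (u w : List (Pos n)) :
    shift K (u ++ w) = shift (shift K u) w := by
  ext q
  simp [shift]

/-- The similarity mapping the unit square onto its sub-square at position `a`. -/
noncomputable def similarity [NeZero n] (a : Pos n) :
    EuclideanSpace ℝ (Fin 2) ≃ₜ EuclideanSpace ℝ (Fin 2) :=
  (Homeomorph.addRight (WithLp.toLp 2 fun c => (a c : ℝ))).trans
    (Homeomorph.smulOfNeZero ((n : ℝ)⁻¹) (inv_ne_zero (NeZero.ne _)))

theorem similarity_apply [NeZero n] (a : Pos n) (x : EuclideanSpace ℝ (Fin 2)) (c : Fin 2) :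
    similarity a x c = (x c + a c) / n := by
  simp [similarity, div_eq_inv_mul, mul_add]

theorem lipschitzWith_similarity [NeZero n] (a : Pos n) :
    LipschitzWith ‖(n : ℝ)⁻¹‖₊ (similarity a) := by
  have h := (lipschitzWith_smul ((n : ℝ)⁻¹)).comp
    (isometry_add_right (WithLp.toLp 2 fun c => (a c : ℝ) : EuclideanSpace ℝ (Fin 2))).lipschitz
  rwa [mul_one] at h

theorem lipschitzWith_similarity_symm [NeZero n] (a : Pos n) :
    LipschitzWith ‖(n : ℝ)‖₊ (similarity a).symm := by
  refine LipschitzWith.of_dist_le_mul fun x y => ?_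
  have hn : ‖(n : ℝ)‖ ≠ 0 := by simpa using NeZero.ne n
  obtain ⟨x, rfl⟩ := (similarity a).surjective x
  obtain ⟨y, rfl⟩ := (similarity a).surjective y
  have : dist (similarity a x) (similarity a y) = ‖(n : ℝ)‖⁻¹ * dist x y := by
    change dist ((n : ℝ)⁻¹ • (x + _)) ((n : ℝ)⁻¹ • (y + _)) = _
    rw [dist_smul₀, dist_add_right, norm_inv]
  rw [this, Homeomorph.symm_apply_apply, Homeomorph.symm_apply_apply, coe_nnnorm,
    mul_inv_cancel_left₀ hn]

theorem similarity_mem_square_cons [NeZero n] {a : Pos n} {w : List (Pos n)}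
    {x : EuclideanSpace ℝ (Fin 2)} : similarity a x ∈ square n (a :: w) ↔ x ∈ square n w := by
  have hn : (0 : ℝ) < n := by exact_mod_cast Nat.pos_of_ne_zero (NeZero.ne n)
  refine forall_congr' fun c => ?_
  rw [similarity_apply, corner, List.length_cons, mem_Icc, mem_Icc]
  have h : ((a c : ℝ) + corner n w c) / n + 1 / (n : ℝ) ^ (w.length + 1) =
      ((a c : ℝ) + (corner n w c + 1 / (n : ℝ) ^ w.length)) / n := by
    field_simp
    ring
  rw [h, div_le_div_iff_of_pos_right hn, div_le_div_iff_of_pos_right hn]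
  constructor <;> rintro ⟨h1, h2⟩ <;> constructor <;> linarith

theorem image_similarity_square [NeZero n] (a : Pos n) (w : List (Pos n)) :
    similarity a '' square n w = square n (a :: w) := by
  ext y
  obtain ⟨x, rfl⟩ := (similarity a).surjective y
  rw [(similarity a).injective.mem_set_image, similarity_mem_square_cons]

theorem square_eq_image (w : List (Pos n)) : square n w = WithLp.toLp 2 ''
    univ.pi fun c => Icc (corner n w c) (corner n w c + 1 / (n : ℝ) ^ w.length) := by
  ext x
  constructor
  · exact fun hx => ⟨fun c => x c, fun c _ => hx c, rfl⟩
  · rintro ⟨y, hy, rfl⟩ c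
    exact hy c (mem_univ c)

theorem isCompact_square (w : List (Pos n)) : IsCompact (square n w) := by
  rw [square_eq_image]
  exact (isCompact_univ_pi fun c => isCompact_Icc).image (PiLp.continuous_toLp 2 _)

theorem isPreconnected_square (w : List (Pos n)) : IsPreconnected (square n w) := by
  rw [square_eq_image]
  exact (isPreconnected_univ_pi fun c => isPreconnected_Icc).image _
    (PiLp.continuous_toLp 2 _).continuousOn

theorem retained_nil (K : Set (List (Pos n) × Pos n)) : Retained K [] := by
  intro u a h
  simp at h

theorem retained_cons {K : Set (List (Pos n) × Pos n)} {a : Pos n} {w : List (Pos n)} :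
    Retained K (a :: w) ↔ ([], a) ∈ K ∧ Retained (shift K [a]) w := by
  constructor
  · intro h
    exact ⟨h [] a (by simp), fun u b hub => h (a :: u) b (by simpa using hub)⟩
  · rintro ⟨h1, h2⟩ u b hub
    cases u with
    | nil =>
      simp only [List.nil_append, List.cons_prefix_cons, List.nil_prefix, and_true] at hub
      exact hub ▸ h1
    | cons a' u =>
      rw [List.cons_append, List.cons_prefix_cons] at hub
      obtain ⟨rfl, hub⟩ := hub
      exact h2 u b hub

theorem retained_append {K : Set (List (Pos n) × Pos n)} {u w : List (Pos n)} :
    Retained K (u ++ w) ↔ Retained K u ∧ Retained (shift K u) w := by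
  induction u generalizing K with
  | nil => simp [retained_nil, shift_nil]
  | cons a u ih =>
    rw [List.cons_append, retained_cons, retained_cons, ih, ← shift_append, and_assoc]
    rfl

theorem Retained.mono {K L : Set (List (Pos n) × Pos n)} (h : K ⊆ L) {w : List (Pos n)}
    (hw : Retained K w) : Retained L w := fun u a hu => h (hw u a hu)

theorem mem_level {K : Set (List (Pos n) × Pos n)} {k : ℕ} {x : EuclideanSpace ℝ (Fin 2)} :
    x ∈ level K k ↔ ∃ w : List (Pos n), w.length = k ∧ Retained K w ∧ x ∈ square n w := by
  simp [level, and_assoc]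

theorem level_mono {K L : Set (List (Pos n) × Pos n)} (h : K ⊆ L) (k : ℕ) :
    level K k ⊆ level L k := by
  intro x hx
  obtain ⟨w, h1, h2, h3⟩ := mem_level.1 hx
  exact mem_level.2 ⟨w, h1, h2.mono h, h3⟩

theorem limitSet_mono {K L : Set (List (Pos n) × Pos n)} (h : K ⊆ L) :
    limitSet K ⊆ limitSet L := iInter₂_mono fun k _ => level_mono h k

theorem level_zero (K : Set (List (Pos n) × Pos n)) : level K 0 = square n [] := by
  ext x
  rw [mem_level]
  constructor
  · rintro ⟨w, h1, -, h3⟩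
    rwa [List.length_eq_zero_iff.1 h1] at h3
  · exact fun hx => ⟨[], rfl, retained_nil K, hx⟩

theorem level_succ [NeZero n] (K : Set (List (Pos n) × Pos n)) (k : ℕ) :
    level K (k + 1) =
      ⋃ a ∈ {a : Pos n | ([], a) ∈ K}, similarity a '' level (shift K [a]) k := by
  ext x
  simp only [mem_level, mem_iUnion, mem_ofPred_eq, exists_prop, mem_image]
  constructor
  · rintro ⟨w, h1, h2, h3⟩
    cases w with
    | nil => simp at h1
    | cons a w =>
      rw [retained_cons] at h2
      rw [← image_similarity_square] at h3
      obtain ⟨y, hy, rfl⟩ := h3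
      exact ⟨a, h2.1, y, ⟨w, by simpa using h1, h2.2, hy⟩, rfl⟩
  · rintro ⟨a, ha, y, ⟨w, h1, h2, h3⟩, rfl⟩
    exact ⟨a :: w, by simp [h1], retained_cons.2 ⟨ha, h2⟩, similarity_mem_square_cons.2 h3⟩

theorem square_subset_unitSquare [NeZero n] (w : List (Pos n)) :
    square n w ⊆ square n ([] : List (Pos n)) := by
  have hn : (0 : ℝ) < n := by exact_mod_cast Nat.pos_of_ne_zero (NeZero.ne n)
  induction w with
  | nil => exact subset_rfl
  | cons a w ih =>
    rw [← image_similarity_square]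
    rintro _ ⟨x, hx, rfl⟩ c
    have h1 := ih hx c
    have h2 : ((a c : ℕ) : ℝ) + 1 ≤ n := by exact_mod_cast (a c).2
    have h3 : (0 : ℝ) ≤ ((a c : ℕ) : ℝ) := by positivity
    simp only [corner, List.length_nil, pow_zero, div_one, zero_add,
      mem_Icc] at h1 ⊢
    rw [similarity_apply, le_div_iff₀ hn, div_le_iff₀ hn]
    constructor <;> linarith

theorem level_succ_subset [NeZero n] (K : Set (List (Pos n) × Pos n)) (k : ℕ) :
    level K (k + 1) ⊆ level K k := by
  induction k generalizing K with
  | zero =>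
    intro x hx
    obtain ⟨w, -, -, h3⟩ := mem_level.1 hx
    exact level_zero K ▸ square_subset_unitSquare w h3
  | succ k ih =>
    rw [level_succ K (k + 1), level_succ K k]
    exact iUnion₂_mono fun a _ => image_mono (ih _)

theorem antitone_level [NeZero n] (K : Set (List (Pos n) × Pos n)) : Antitone (level K) :=
  antitone_nat_of_succ_le (level_succ_subset K)

theorem limitSet_eq_iInter [NeZero n] (K : Set (List (Pos n) × Pos n)) :
    limitSet K = ⋂ k, level K k := by
  refine Subset.antisymm (fun x hx => mem_iInter.2 fun k => ?_) fun x hx =>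
    mem_iInter₂.2 fun k _ => mem_iInter.1 hx k
  exact level_succ_subset K k (mem_iInter₂.1 hx (k + 1) (by simp))

theorem isCompact_level (K : Set (List (Pos n) × Pos n)) (k : ℕ) : IsCompact (level K k) :=
  ((List.finite_length_eq (Pos n) k).subset fun _ hw => hw.1).isCompact_biUnion
    fun w _ => isCompact_square w

theorem isCompact_limitSet [NeZero n] (K : Set (List (Pos n) × Pos n)) :
    IsCompact (limitSet K) := by
  rw [limitSet_eq_iInter]
  exact (isCompact_level K 0).of_isClosed_subset
    (isClosed_iInter fun k => (isCompact_level K k).isClosed) (iInter_subset _ 0)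

/-- The limit set consists of scaled copies of the limit sets seen from the kept squares of the
first level. -/
theorem limitSet_eq_iUnion [NeZero n] (K : Set (List (Pos n) × Pos n)) :
    limitSet K = ⋃ a : {a : Pos n // ([], a) ∈ K}, similarity a.1 '' limitSet (shift K [a.1]) := by
  ext x
  constructor
  · intro hx
    by_contra hno
    simp only [mem_iUnion, not_exists] at hno
    have h : ∀ a : {a : Pos n // ([], a) ∈ K},
        ∃ k, x ∉ similarity a.1 '' level (shift K [a.1]) k := by
      intro a
      by_contra hall
      push Not at hall
      refine hno a ⟨(similarity a.1).symm x, ?_, by simp⟩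
      rw [limitSet_eq_iInter]
      refine mem_iInter.2 fun k => ?_
      obtain ⟨y, hy, rfl⟩ := hall k
      simpa using hy
    choose k hk using h
    obtain ⟨m, hm⟩ : ∃ m, ∀ a, k a ≤ m := by
      cases nonempty_fintype {a : Pos n // ([], a) ∈ K}
      exact ⟨Finset.univ.sup k, fun a => Finset.le_sup (Finset.mem_univ a)⟩
    rw [limitSet_eq_iInter] at hx
    have hx' := mem_iInter.1 hx (m + 1)
    rw [level_succ] at hx'
    obtain ⟨a, ha, hxa⟩ := mem_iUnion₂.1 hx'
    exact hk ⟨a, ha⟩ (image_mono (antitone_level _ (hm ⟨a, ha⟩)) hxa)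
  · intro hx
    obtain ⟨⟨a, ha⟩, y, hy, rfl⟩ := mem_iUnion.1 hx
    rw [limitSet_eq_iInter] at hy
    refine mem_iInter₂.2 fun k hk => ?_
    obtain ⟨k, rfl⟩ : ∃ j, k = j + 1 := ⟨k - 1, by simp at hk; omega⟩
    rw [level_succ]
    exact mem_biUnion ha ⟨y, mem_iInter.1 hy k, rfl⟩

theorem limitSet_eq_empty_iff [NeZero n] {K : Set (List (Pos n) × Pos n)} :
    limitSet K = ∅ ↔ ∀ a, ([], a) ∈ K → limitSet (shift K [a]) = ∅ := by
  rw [limitSet_eq_iUnion]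
  simp

theorem isZeroDimMod_limitSet_iff [NeZero n] {s : ℝ} {K : Set (List (Pos n) × Pos n)} :
    IsZeroDimMod s (limitSet K) ↔
      ∀ a, ([], a) ∈ K → IsZeroDimMod s (limitSet (shift K [a])) := by
  constructor
  · intro h a ha
    have h1 : similarity a '' limitSet (shift K [a]) ⊆ limitSet K := by
      rw [limitSet_eq_iUnion K]
      exact subset_iUnion (fun a : {a : Pos n // ([], a) ∈ K} =>
        similarity a.1 '' limitSet (shift K [a.1])) ⟨a, ha⟩
    have h2 := (h.mono h1).image (similarity a).symm (lipschitzWith_similarity_symm a)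
    rwa [← image_comp, Homeomorph.symm_comp_self, image_id] at h2
  · intro h
    rw [limitSet_eq_iUnion]
    exact .iUnion fun a => (h a.1 a.2).image _ (lipschitzWith_similarity a.1)

end LimitSet

/-! ### Measurability of events about the limit set -/

section Measurability

variable {n : ℕ}

theorem measurableSet_retained (w : List (Pos n)) :
    MeasurableSet {K : Set (List (Pos n) × Pos n) | Retained K w} := by
  simp only [Retained, ofPred_forall]
  exact .iInter fun u => .iInter fun a => .iInter fun _ =>
    measurableSet_setOfPred.2 (measurable_set_mem (u, a))

theorem measurable_shift (w : List (Pos n)) :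
    Measurable fun K : Set (List (Pos n) × Pos n) => shift K w :=
  measurable_set_iff.2 fun q => measurable_set_mem (w ++ q.1, q.2)

/-- Events depending only on which squares of a given level are kept are measurable. -/
theorem measurableSet_of_level (k : ℕ) (p : Set (List (Pos n)) → Prop) :
    MeasurableSet {K : Set (List (Pos n) × Pos n) | p {w | w.length = k ∧ Retained K w}} := by
  have hfin : {T : Set (List (Pos n)) | T ⊆ {w | w.length = k}}.Finite :=
    (List.finite_length_eq (Pos n) k).finite_subsets
  have : {K : Set (List (Pos n) × Pos n) | p {w | w.length = k ∧ Retained K w}} =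
      ⋃ T ∈ {T : Set (List (Pos n)) | T ⊆ {w | w.length = k} ∧ p T},
        {K | {w | w.length = k ∧ Retained K w} = T} := by
    ext K
    simp only [mem_ofPred_eq, mem_iUnion, exists_prop]
    constructor
    · exact fun h => ⟨_, ⟨fun w hw => hw.1, h⟩, rfl⟩
    · rintro ⟨T, ⟨-, h⟩, rfl⟩
      exact h
  rw [this]
  refine .biUnion (hfin.subset fun T hT => hT.1).countable fun T _ => ?_
  simp only [Set.ext_iff, ofPred_forall, mem_ofPred_eq]
  refine .iInter fun w => measurableSet_setOfPred.2 ?_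
  refine Measurable.iff (Measurable.and measurable_const ?_) measurable_const
  exact measurableSet_setOfPred.1 (measurableSet_retained w)

/-- The limit set depends upper semicontinuously on the choices, so that being contained in an open
set of any given kind is an event. -/
theorem measurableSet_exists_limitSet_subset [NeZero n]
    {p : Set (EuclideanSpace ℝ (Fin 2)) → Prop} (hp : ∀ O, p O → IsOpen O) :
    MeasurableSet {K : Set (List (Pos n) × Pos n) | ∃ O, p O ∧ limitSet K ⊆ O} := by
  have : {K : Set (List (Pos n) × Pos n) | ∃ O, p O ∧ limitSet K ⊆ O} =
      ⋃ k, {K | ∃ O, p O ∧ level K k ⊆ O} := by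
    ext K
    simp only [mem_ofPred_eq, mem_iUnion]
    constructor
    · rintro ⟨O, hO, h⟩
      rw [limitSet_eq_iInter] at h
      obtain ⟨k, hk⟩ := exists_subset_nhds_of_isCompact (antitone_level K).directed_ge
        (fun k => isCompact_level K k) (U := O) fun x hx => (hp O hO).mem_nhds (h hx)
      exact ⟨k, O, hO, hk⟩
    · rintro ⟨k, O, hO, h⟩
      refine ⟨O, hO, Subset.trans ?_ h⟩
      rw [limitSet_eq_iInter]
      exact iInter_subset _ k
  rw [this]
  exact .iUnion fun k => measurableSet_of_level k fun T => ∃ O, p O ∧ (⋃ w ∈ T, square n w) ⊆ O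

theorem measurableSet_limitSet_eq_empty [NeZero n] :
    MeasurableSet {K : Set (List (Pos n) × Pos n) | limitSet K = ∅} := by
  simpa using measurableSet_exists_limitSet_subset (n := n) (p := fun O => O = ∅)
    (by rintro _ rfl; exact isOpen_empty)

theorem measurableSet_isZeroDimMod [NeZero n] (s : ℝ) :
    MeasurableSet {K : Set (List (Pos n) × Pos n) | IsZeroDimMod s (limitSet K)} := by
  simp only [isZeroDimMod_iff_forall_isFine (isCompact_limitSet _), ofPred_forall]
  exact .iInter fun m => measurableSet_exists_limitSet_subset fun O hO => hO.isOpen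

end Measurability

/-! ### Crossings of squares with few bad sub-squares -/

section Crossing

variable {N : ℕ} {G : List (Pos N) → Prop}

open Classical in
/-- Fewer than half of the rows (or columns) of a good square contain a bad sub-square, so two good
squares have a common row without bad sub-squares. -/
theorem exists_common_line
    (hG : ∀ u, G u → 2 * (Finset.univ.filter fun a : Pos N => ¬ G (u ++ [a])).card < N)
    {u v : List (Pos N)} (hu : G u) (hv : G v) (f : Fin 2) :
    ∃ r : Fin N, ∀ b : Pos N, b f = r → G (u ++ [b]) ∧ G (v ++ [b]) := by
  by_contra! hno
  have hcov : (Finset.univ : Finset (Fin N)) ⊆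
      (Finset.univ.filter fun a : Pos N => ¬ G (u ++ [a])).image (fun a => a f) ∪
      (Finset.univ.filter fun a : Pos N => ¬ G (v ++ [a])).image (fun a => a f) := by
    intro r _
    obtain ⟨b, rfl, hb⟩ := hno r
    simp only [Finset.mem_union, Finset.mem_image, Finset.mem_filter, Finset.mem_univ, true_and]
    by_cases h : G (u ++ [b])
    · exact Or.inr ⟨b, hb h, rfl⟩
    · exact Or.inl ⟨b, h, rfl⟩
  have h1 := (Finset.card_le_card hcov).trans (Finset.card_union_le _ _)
  rw [Finset.card_univ, Fintype.card_fin] at h1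
  have h2 := hG u hu
  have h3 := hG v hv
  have h4 := Finset.card_image_le (s := Finset.univ.filter fun a : Pos N => ¬ G (u ++ [a]))
    (f := fun a => a f)
  have h5 := Finset.card_image_le (s := Finset.univ.filter fun a : Pos N => ¬ G (v ++ [a]))
    (f := fun a => a f)
  omega

variable [NeZero N]

/-- Given a set `G` of words, called good, this is the approximation of depth `k` to the set seen
from the square `u` if in every square one keeps only the sub-squares lying in a row or a column
all of whose sub-squares are good. -/
noncomputable def fullLineSet (G : List (Pos N) → Prop) :
    ℕ → List (Pos N) → Set (EuclideanSpace ℝ (Fin 2))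
  | 0, _ => square N ([] : List (Pos N))
  | k + 1, u => ⋃ a ∈ {a : Pos N | ∃ f, ∀ b : Pos N, b f = a f → G (u ++ [b])},
      similarity a '' fullLineSet G k (u ++ [a])

/-- The part of `fullLineSet G (k + 1) u` over the row or column on which the coordinate `f` of the
position is `r`. -/
noncomputable def lineSet (G : List (Pos N) → Prop) (k : ℕ) (u : List (Pos N)) (f : Fin 2)
    (r : Fin N) : Set (EuclideanSpace ℝ (Fin 2)) :=
  ⋃ a ∈ {a : Pos N | a f = r}, similarity a '' fullLineSet G k (u ++ [a])

theorem fullLineSet_succ (k : ℕ) (u : List (Pos N)) :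
    fullLineSet G (k + 1) u =
      ⋃ (f : Fin 2) (r ∈ {r | ∀ b : Pos N, b f = r → G (u ++ [b])}), lineSet G k u f r := by
  ext x
  simp only [fullLineSet, lineSet, mem_iUnion, mem_ofPred_eq, exists_prop]
  constructor
  · rintro ⟨a, ⟨f, hf⟩, hx⟩
    exact ⟨f, a f, hf, a, rfl, hx⟩
  · rintro ⟨f, _, hf, a, rfl, hx⟩
    exact ⟨a, ⟨f, hf⟩, hx⟩

theorem isCompact_fullLineSet (k : ℕ) (u : List (Pos N)) : IsCompact (fullLineSet G k u) := by
  induction k generalizing u with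
  | zero => exact isCompact_square _
  | succ k ih =>
    exact (toFinite _).isCompact_biUnion fun a _ => (ih _).image (similarity a).continuous

theorem antitone_fullLineSet (u : List (Pos N)) : Antitone fun k => fullLineSet G k u := by
  refine antitone_nat_of_succ_le fun k => ?_
  induction k generalizing u with
  | zero =>
    refine iUnion₂_subset fun a _ => ?_
    change similarity a '' square N [] ⊆ _
    rw [image_similarity_square]
    exact square_subset_unitSquare _
  | succ k ih => exact iUnion₂_mono fun a _ => image_mono (ih _)

theorem exists_mem_square_of_mem_fullLineSet {k : ℕ} {u : List (Pos N)} (hu : G u)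
    {x : EuclideanSpace ℝ (Fin 2)} (hx : x ∈ fullLineSet G k u) :
    ∃ w : List (Pos N), w.length = k ∧ x ∈ square N w ∧ ∀ v, v <+: w → G (u ++ v) := by
  induction k generalizing u x with
  | zero => exact ⟨[], rfl, hx, fun v hv => by simpa [List.prefix_nil.1 hv] using hu⟩
  | succ k ih =>
    obtain ⟨a, ⟨f, hf⟩, y, hy, rfl⟩ := mem_iUnion₂.1 hx
    obtain ⟨w, h1, h2, h3⟩ := ih (hf a rfl) hy
    refine ⟨a :: w, by simp [h1], similarity_mem_square_cons.2 h2, fun v hv => ?_⟩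
    cases v with
    | nil => simpa using hu
    | cons b v =>
      rw [List.cons_prefix_cons] at hv
      obtain ⟨rfl, hv⟩ := hv
      simpa using h3 v hv

open Classical in
/-- The sets over two good squares placed next to each other in the direction of the axis `e`
meet. -/
theorem exists_matching_points
    (hG : ∀ u, G u → 2 * (Finset.univ.filter fun a : Pos N => ¬ G (u ++ [a])).card < N)
    (k : ℕ) {u v : List (Pos N)} (hu : G u) (hv : G v) (e : Fin 2) :
    ∃ x ∈ fullLineSet G k u, ∃ y ∈ fullLineSet G k v,
      x e = 1 ∧ y e = 0 ∧ ∀ c, c ≠ e → x c = y c := by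
  have hN : (N : ℝ) ≠ 0 := by exact_mod_cast NeZero.ne N
  induction k generalizing u v with
  | zero =>
    refine ⟨WithLp.toLp 2 (Pi.single e 1), fun c => ?_, 0, fun c => ?_, by simp, by simp,
      fun c hc => by simp [hc]⟩
    · by_cases hc : c = e <;> simp [corner, hc]
    · simp [corner]
  | succ k ih =>
    obtain ⟨f, hf⟩ := exists_ne e
    obtain ⟨r, hr⟩ := exists_common_line hG hu hv f
    let a : Pos N := fun c => if c = e then Fin.ofNat N (N - 1) else r
    let b : Pos N := fun c => if c = e then Fin.ofNat N 0 else r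
    have haf : a f = r := by simp [a, hf]
    have hbf : b f = r := by simp [b, hf]
    obtain ⟨x, hx, y, hy, h1, h2, h3⟩ := ih (hr a haf).1 (hr b hbf).2
    refine ⟨similarity a x,
      mem_biUnion (show a ∈ _ from ⟨f, fun b' hb' => (hr b' (hb'.trans haf)).1⟩)
      ⟨x, hx, rfl⟩, similarity b y,
      mem_biUnion (show b ∈ _ from ⟨f, fun b' hb' => (hr b' (hb'.trans hbf)).2⟩)
      ⟨y, hy, rfl⟩, ?_, ?_, fun c hc => ?_⟩
    · have : ((a e : ℕ) : ℝ) = N - 1 := by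
        have h : (a e : ℕ) = N - 1 := by
          simp only [a, if_true, Fin.ofNat]
          exact Nat.mod_eq_of_lt (Nat.sub_lt (Nat.pos_of_ne_zero (NeZero.ne N)) one_pos)
        rw [h, Nat.cast_sub (Nat.pos_of_ne_zero (NeZero.ne N)), Nat.cast_one]
      rw [similarity_apply, h1, this]
      field_simp
      ring
    · rw [similarity_apply, h2]
      simp [b]
    · rw [similarity_apply, similarity_apply, h3 c hc]
      simp [a, b, hc]

open Classical in
theorem isPreconnected_lineSet
    (hG : ∀ u, G u → 2 * (Finset.univ.filter fun a : Pos N => ¬ G (u ++ [a])).card < N)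
    {k : ℕ} (hpre : ∀ u, G u → IsPreconnected (fullLineSet G k u)) {u : List (Pos N)} {f : Fin 2}
    {r : Fin N} (hr : ∀ b : Pos N, b f = r → G (u ++ [b])) :
    IsPreconnected (lineSet G k u f r) := by
  let a : ℕ → Pos N := fun i c => if c = f then r else Fin.ofNat N i
  have haf : ∀ i, a i f = r := fun i => by simp [a]
  have heq : lineSet G k u f r =
      ⋃ i ∈ Iio N, similarity (a i) '' fullLineSet G k (u ++ [a i]) := by
    refine Subset.antisymm (iUnion₂_subset fun b hb => ?_) (iUnion₂_subset fun i _ =>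
      subset_biUnion_of_mem (u := fun a => similarity a '' fullLineSet G k (u ++ [a])) (haf i))
    obtain ⟨e, he⟩ := exists_ne f
    have : b = a (b e) := by
      funext c
      by_cases hc : c = f
      · simp [a, hc, show b f = r from hb]
      · have : c = e := by omega
        subst this
        simp [a, hc]
    intro x hx
    exact mem_biUnion (show (b e : ℕ) ∈ Iio N from (b e).2) (this ▸ hx)
  rw [heq]
  refine IsPreconnected.biUnion_of_chain ordConnected_Iio
    (fun i _ => (hpre _ (hr _ (haf i))).image _ (similarity _).continuous.continuousOn) ?_
  intro i hi hi'
  rw [Order.succ_eq_add_one] at hi' ⊢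
  obtain ⟨e, he⟩ := exists_ne f
  obtain ⟨x, hx, y, hy, h1, h2, h3⟩ := exists_matching_points hG k (hr _ (haf i))
    (hr _ (haf (i + 1))) e
  refine ⟨similarity (a i) x, ⟨x, hx, rfl⟩, y, hy, ?_⟩
  ext c
  rw [similarity_apply, similarity_apply]
  by_cases hc : c = e
  · subst hc
    have h4 : (a i c : ℕ) = i := by simpa [a, he] using Nat.mod_eq_of_lt hi
    have h5 : (a (i + 1) c : ℕ) = i + 1 := by simpa [a, he] using Nat.mod_eq_of_lt hi'
    rw [h1, h2, h4, h5]
    push_cast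
    ring
  · have : c = f := by omega
    rw [h3 c hc, this, haf, haf]

open Classical in
theorem isPreconnected_fullLineSet
    (hG : ∀ u, G u → 2 * (Finset.univ.filter fun a : Pos N => ¬ G (u ++ [a])).card < N)
    (k : ℕ) {u : List (Pos N)} (hu : G u) : IsPreconnected (fullLineSet G k u) := by
  induction k generalizing u with
  | zero => exact isPreconnected_square _
  | succ k ih =>
    have hr : ∀ f, ∃ r : Fin N, ∀ b : Pos N, b f = r → G (u ++ [b]) := fun f =>
      (exists_common_line hG hu hu f).imp fun r h b hb => (h b hb).1
    choose r hr using hr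
    -- any row meets any column
    have hmeet : ∀ (r : Fin 2 → Fin N), (∀ f, ∀ b : Pos N, b f = r f → G (u ++ [b])) →
        ∃ x, ∀ f, x ∈ lineSet G k u f (r f) := by
      intro r hr
      have hgr : G (u ++ [r]) := hr 0 r rfl
      obtain ⟨x, hx, -⟩ := exists_matching_points hG k hgr hgr 0
      exact ⟨similarity r x, fun f => mem_biUnion (show r ∈ {a : Pos N | a f = r f} from rfl)
        ⟨x, hx, rfl⟩⟩
    obtain ⟨x, hx⟩ := hmeet r hr
    refine isPreconnected_of_forall x fun y hy => ?_
    rw [fullLineSet_succ] at hy ⊢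
    obtain ⟨f, hy⟩ := mem_iUnion.1 hy
    obtain ⟨t, ht, hy⟩ := mem_iUnion₂.1 hy
    obtain ⟨e, he⟩ := exists_ne f
    have hsub : ∀ f t, (∀ b : Pos N, b f = t → G (u ++ [b])) → lineSet G k u f t ⊆
        ⋃ (f : Fin 2) (r ∈ {r | ∀ b : Pos N, b f = r → G (u ++ [b])}), lineSet G k u f r :=
      fun f t ht z hz => mem_iUnion.2 ⟨f, mem_biUnion (show t ∈ _ from ht) hz⟩
    refine ⟨lineSet G k u f t ∪ lineSet G k u e (r e),
      union_subset (hsub f t ht) (hsub e (r e) (hr e)), Or.inr (hx e), Or.inl hy, ?_⟩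
    obtain ⟨z, hz⟩ := hmeet (Function.update r f t) fun g b hb => by
      by_cases hg : g = f
      · subst hg
        exact ht b (by simpa using hb)
      · exact hr g b (by simpa [hg] using hb)
    have hzf := hz f
    have hze := hz e
    rw [Function.update_self] at hzf
    rw [Function.update_of_ne he] at hze
    exact (isPreconnected_lineSet hG (fun _ => ih) ht).union z hzf hze
      (isPreconnected_lineSet hG (fun _ => ih) (hr e))

open Classical in
/-- If in every good square few sub-squares are bad, then the limit of the good squares cannot be
separated between the left and the right side of the unit square. -/
theorem exists_notMem_of_separation
    (hG : ∀ u, G u → 2 * (Finset.univ.filter fun a : Pos N => ¬ G (u ++ [a])).card < N)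
    (h0 : G []) {U V : Set (EuclideanSpace ℝ (Fin 2))} (hU : IsOpen U) (hV : IsOpen V)
    (hUV : Disjoint U V) (hleft : {x : EuclideanSpace ℝ (Fin 2) | x 0 = 0} ⊆ U)
    (hright : {x : EuclideanSpace ℝ (Fin 2) | x 0 = 1} ⊆ V) :
    ∃ x, x ∉ U ∪ V ∧ ∀ k, ∃ w : List (Pos N), w.length = k ∧ x ∈ square N w ∧
      ∀ v, v <+: w → G v := by
  by_contra! hno
  have hsub : (⋂ k, fullLineSet G k []) ⊆ U ∪ V := by
    intro x hx
    by_contra hxUV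
    obtain ⟨k, hk⟩ := hno x hxUV
    obtain ⟨w, h1, h2, h3⟩ := exists_mem_square_of_mem_fullLineSet h0 (mem_iInter.1 hx k)
    obtain ⟨v, hv, hv'⟩ := hk w h1 h2
    exact hv' (by simpa using h3 v hv)
  obtain ⟨k, hk⟩ := exists_subset_nhds_of_isCompact (antitone_fullLineSet []).directed_ge
    (fun k => isCompact_fullLineSet k []) (U := U ∪ V)
    fun x hx => (hU.union hV).mem_nhds (hsub hx)
  obtain ⟨x, hx, y, hy, hx1, hy0, -⟩ := exists_matching_points hG k h0 h0 0
  obtain ⟨z, -, hzU, hzV⟩ := isPreconnected_fullLineSet hG k h0 U V hU hV hk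
    ⟨y, hy, hleft hy0⟩ ⟨x, hx, hright hx1⟩
  exact hUV.ne_of_mem hzU hzV rfl

end Crossing

/-! ### Grid coordinates of squares -/

section CornerIndex

/-- The integer coordinates of a square in the grid of its level. -/
def cornerIndex (n : ℕ) : List (Pos n) → Fin 2 → ℕ
  | [], _ => 0
  | a :: w, c => a c * n ^ w.length + cornerIndex n w c

theorem cornerIndex_lt {n : ℕ} (w : List (Pos n)) (c : Fin 2) :
    cornerIndex n w c < n ^ w.length := by
  induction w with
  | nil => simp [cornerIndex]
  | cons a w ih =>
    rw [cornerIndex, List.length_cons, pow_succ']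
    calc (a c : ℕ) * n ^ w.length + cornerIndex n w c
        < a c * n ^ w.length + n ^ w.length := by omega
      _ = (a c + 1) * n ^ w.length := by ring
      _ ≤ n * n ^ w.length := Nat.mul_le_mul_right _ (a c).2

theorem corner_eq_div {n : ℕ} [NeZero n] (w : List (Pos n)) (c : Fin 2) :
    corner n w c = cornerIndex n w c / (n : ℝ) ^ w.length := by
  have hn : (n : ℝ) ≠ 0 := by exact_mod_cast NeZero.ne n
  induction w with
  | nil => simp [corner, cornerIndex]
  | cons a w ih =>
    rw [corner, cornerIndex, ih, List.length_cons]
    push_cast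
    field_simp
    ring

theorem cornerIndex_injOn (n k : ℕ) :
    InjOn (cornerIndex n) {w : List (Pos n) | w.length = k} := by
  induction k with
  | zero =>
    intro v hv w hw _
    rw [List.length_eq_zero_iff.1 hv, List.length_eq_zero_iff.1 hw]
  | succ k ih =>
    intro v hv w hw h
    cases v with
    | nil => simp at hv
    | cons a v =>
    cases w with
    | nil => simp at hw
    | cons b w =>
    have hv' : v.length = k := by simpa using hv
    have hw' : w.length = k := by simpa using hw
    have hpt : ∀ c, a c = b c ∧ cornerIndex n v c = cornerIndex n w c := by
      intro c
      have h1 := congrFun h c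
      simp only [cornerIndex, hv', hw'] at h1
      have h2 := hv' ▸ cornerIndex_lt v c
      have h3 := hw' ▸ cornerIndex_lt w c
      have hpos : 0 < n ^ k := by omega
      have h4 := congrArg (· / n ^ k) h1
      have h5 := congrArg (· % n ^ k) h1
      simp only [mul_comm _ (n ^ k), Nat.mul_add_div hpos, Nat.div_eq_of_lt h2,
        Nat.div_eq_of_lt h3, add_zero, Nat.mul_add_mod, Nat.mod_eq_of_lt h2,
        Nat.mod_eq_of_lt h3] at h4 h5
      exact ⟨Fin.ext h4, h5⟩
    rw [funext fun c => (hpt c).1, ih hv' hw' (funext fun c => (hpt c).2)]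

theorem exists_cornerIndex_eq (n k : ℕ) (m : Fin 2 → ℕ) (hm : ∀ c, m c < n ^ k) :
    ∃ w : List (Pos n), w.length = k ∧ cornerIndex n w = m := by
  induction k generalizing m with
  | zero => exact ⟨[], rfl, funext fun c => by have := hm c; simp [cornerIndex] at this ⊢; omega⟩
  | succ k ih =>
    have hpos : 0 < n ^ k := by
      have := hm 0
      rcases Nat.eq_zero_or_pos n with rfl | hn
      · simp at this
      · positivity
    obtain ⟨w, h1, h2⟩ := ih (fun c => m c % n ^ k) fun c => Nat.mod_lt _ hpos
    refine ⟨(fun c => ⟨m c / n ^ k, ?_⟩) :: w, by simp [h1], funext fun c => ?_⟩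
    · rw [Nat.div_lt_iff_lt_mul hpos, ← pow_succ']
      exact hm c
    · rw [cornerIndex, h2, h1]
      exact Nat.div_add_mod' (m c) (n ^ k)

/-- A set of diameter at most the side length of the squares meets at most `16` squares. -/
theorem ncard_squares_le {n : ℕ} [NeZero n] (k : ℕ) {A : Set (EuclideanSpace ℝ (Fin 2))}
    (hA : ediam A ≤ (n : ℝ≥0∞)⁻¹ ^ k) :
    {w : List (Pos n) | w.length = k ∧ (A ∩ square n w).Nonempty}.ncard ≤ 16 := by
  have hn : (0 : ℝ) < n := by exact_mod_cast Nat.pos_of_ne_zero (NeZero.ne n)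
  rcases A.eq_empty_or_nonempty with rfl | ⟨x, hx⟩
  · simp
  let z : Fin 2 → ℤ := fun c => ⌊x c * (n : ℝ) ^ k⌋
  let B : Finset (Fin 2 → ℤ) := Fintype.piFinset fun c => Finset.Icc (z c - 2) (z c + 1)
  have hB : B.card = 16 := by
    simp only [B, Fintype.card_piFinset, Int.card_Icc]
    have : ∀ c, (z c + 1 + 1 - (z c - 2)).toNat = 4 := fun c => by omega
    simp [this]
  rw [← hB, ← Set.ncard_coe_finset]
  refine ncard_le_ncard_of_injOn (fun w c => (cornerIndex n w c : ℤ)) ?_ ?_ B.finite_toSet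
  · rintro w ⟨hw, y, hyA, hy⟩
    simp only [B, Finset.mem_coe, Fintype.mem_piFinset, Finset.mem_Icc]
    intro c
    have hd : dist y x ≤ ((n : ℝ) ^ k)⁻¹ := by
      have h1 := (edist_le_ediam_of_mem hyA hx).trans hA
      rw [edist_dist, ENNReal.ofReal_le_iff_le_toReal (by simp [NeZero.ne])] at h1
      simpa using h1
    have hc : |y c - x c| ≤ ((n : ℝ) ^ k)⁻¹ := by
      have := (PiLp.norm_apply_le (y - x) c).trans (dist_eq_norm y x ▸ hd)
      simpa using this
    have hp : (0 : ℝ) < (n : ℝ) ^ k := by positivity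
    have h2 := hy c
    rw [corner_eq_div, hw, mem_Icc, ← add_div, div_le_iff₀ hp, le_div_iff₀ hp] at h2
    rw [abs_le] at hc
    have h3 : (y c - x c) * (n : ℝ) ^ k ≤ 1 :=
      (mul_le_mul_of_nonneg_right hc.2 hp.le).trans_eq (inv_mul_cancel₀ hp.ne')
    have h4 : -1 ≤ (y c - x c) * (n : ℝ) ^ k := by
      have := mul_le_mul_of_nonneg_right hc.1 hp.le
      rwa [neg_mul, inv_mul_cancel₀ hp.ne'] at this
    have h5 : (z c : ℝ) ≤ x c * (n : ℝ) ^ k := Int.floor_le _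
    have h6 : x c * (n : ℝ) ^ k < z c + 1 := Int.lt_floor_add_one _
    constructor
    · have : (z c : ℝ) - 2 ≤ cornerIndex n w c := by linarith
      exact_mod_cast this
    · have : (cornerIndex n w c : ℝ) < z c + 2 := by linarith
      have h7 : (cornerIndex n w c : ℤ) < z c + 2 := by exact_mod_cast this
      omega
  · intro v hv w hw h
    refine cornerIndex_injOn n k hv.1 hw.1 (funext fun c => ?_)
    simpa using congrFun h c

end CornerIndex

/-! ### Coverings by squares and large separators -/

section Covering

variable {N : ℕ}

/-- A scale at which a given bounded set can be covered by boundedly many squares without losing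
more than a constant factor in its `s`-dimensional weight. -/
theorem exists_scale (hN : 2 ≤ N) {s : ℝ} (hs : 0 < s) {δ ε : ℝ≥0∞} (hδ : δ ≤ 1) (hε : 0 < ε) :
    ∃ k : ℕ, δ ≤ (N : ℝ≥0∞)⁻¹ ^ k ∧
      ((N : ℝ≥0∞)⁻¹ ^ s) ^ k ≤ (N : ℝ≥0∞) ^ s * (δ ^ s + ε) := by
  set y : ℝ≥0∞ := (N : ℝ≥0∞)⁻¹ with hy
  have hN0 : (N : ℝ≥0∞) ≠ 0 := by simp; omega
  have hNt : (N : ℝ≥0∞) ≠ ∞ := ENNReal.natCast_ne_top N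
  have hy1 : y < 1 := by
    rw [hy, ENNReal.inv_lt_one]
    exact_mod_cast (by omega : 1 < N)
  -- a positive lower bound for the size keeps the scale finite when `δ = 0`
  set t : ℝ≥0∞ := min 1 (ε ^ s⁻¹) with ht
  have ht0 : 0 < t := lt_min one_pos (ENNReal.rpow_pos_of_nonneg hε (by positivity))
  have hts : t ^ s ≤ ε := by
    calc t ^ s ≤ (ε ^ s⁻¹) ^ s := ENNReal.rpow_le_rpow (min_le_right _ _) hs.le
      _ = ε := ENNReal.rpow_inv_rpow hs.ne' ε
  have hr1 : max δ t ≤ 1 := max_le hδ (min_le_left _ _)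
  have hex : ∃ k : ℕ, y ^ k < max δ t :=
    ((ENNReal.tendsto_pow_atTop_nhds_zero_of_lt_one hy1).eventually_lt_const
      (lt_max_of_lt_right ht0)).exists
  classical
  obtain ⟨k, hk⟩ : ∃ k, Nat.find hex = k + 1 := by
    refine Nat.exists_eq_succ_of_ne_zero fun h0 => ?_
    have := Nat.find_spec hex
    rw [h0, pow_zero] at this
    exact this.not_ge hr1
  have h1 : max δ t ≤ y ^ k := not_lt.1 (Nat.find_min hex (by omega))
  have h2 : y ^ (k + 1) < max δ t := hk ▸ Nat.find_spec hex
  refine ⟨k, (le_max_left _ _).trans h1, ?_⟩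
  calc (y ^ s) ^ k = (N * y ^ (k + 1)) ^ s := by
        rw [pow_succ', ← mul_assoc, hy, ENNReal.mul_inv_cancel hN0 hNt, one_mul,
          ← ENNReal.rpow_natCast, ← ENNReal.rpow_natCast, ← ENNReal.rpow_mul, ← ENNReal.rpow_mul,
          mul_comm]
    _ = (N : ℝ≥0∞) ^ s * (y ^ (k + 1)) ^ s := ENNReal.mul_rpow_of_nonneg _ _ hs.le
    _ ≤ (N : ℝ≥0∞) ^ s * (max δ t) ^ s := by gcongr
    _ ≤ (N : ℝ≥0∞) ^ s * (δ ^ s + ε) := by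
        gcongr
        rw [(ENNReal.monotone_rpow_of_nonneg hs.le).map_max]
        exact max_le le_self_add (hts.trans le_add_self)

/-- A set of vanishing `s`-dimensional Hausdorff measure can be covered by squares of total weight
less than one, in the sense that each of its points has a level all of whose squares containing the
point are used. -/
theorem exists_square_cover (hN : 2 ≤ N) {s : ℝ} (hs : 0 < s) {S : Set (EuclideanSpace ℝ (Fin 2))}
    (hS : μH[s] S = 0) :
    ∃ C : Set (List (Pos N)), ∑' w : C, ((N : ℝ≥0∞)⁻¹ ^ s) ^ w.1.length < 1 ∧
      ∀ x ∈ S, ∃ k, ∀ w : List (Pos N), w.length = k → x ∈ square N w → w ∈ C := by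
  have : NeZero N := ⟨by omega⟩
  have hNs0 : (N : ℝ≥0∞) ^ s ≠ 0 := by
    simp [ENNReal.rpow_eq_zero_iff, NeZero.ne, hs.not_gt]
  have hNst : (N : ℝ≥0∞) ^ s ≠ ∞ := ENNReal.rpow_ne_top_of_nonneg hs.le (by simp)
  obtain ⟨ε, hε0, hε⟩ : ∃ ε : ℝ≥0∞, 0 < ε ∧ ε < min 1 (16 * (N : ℝ≥0∞) ^ s * 2)⁻¹ := by
    refine exists_between (lt_min one_pos (ENNReal.inv_pos.2 ?_))
    exact ENNReal.mul_ne_top (ENNReal.mul_ne_top (by simp) hNst) (by simp)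
  obtain ⟨W, hSW, A, -, hA1, rfl, hA2⟩ := exists_isSmall_of_hausdorffMeasure_eq_zero hS hε0
  obtain ⟨ε', hε', hsum⟩ := ENNReal.exists_pos_sum_of_countable' hε0.ne' ℕ
  have hk := fun i => exists_scale hN hs ((hA1 i).trans (hε.trans_le (min_le_left _ _)).le) (hε' i)
  choose k hk1 hk2 using hk
  refine ⟨⋃ i, {w | w.length = k i ∧ (A i ∩ square N w).Nonempty}, ?_, fun x hx => ?_⟩
  · calc ∑' w : (⋃ i, {w : List (Pos N) | w.length = k i ∧ (A i ∩ square N w).Nonempty}),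
          ((N : ℝ≥0∞)⁻¹ ^ s) ^ w.1.length
        ≤ ∑' i, ∑' w : {w : List (Pos N) | w.length = k i ∧ (A i ∩ square N w).Nonempty},
          ((N : ℝ≥0∞)⁻¹ ^ s) ^ w.1.length :=
          ENNReal.tsum_iUnion_le_tsum (fun w : List (Pos N) => ((N : ℝ≥0∞)⁻¹ ^ s) ^ w.length) _
      _ ≤ ∑' i, 16 * (N : ℝ≥0∞) ^ s * ((⨆ _ : (A i).Nonempty, ediam (A i) ^ s) + ε' i) := by
          refine ENNReal.tsum_le_tsum fun i => ?_
          set B := {w : List (Pos N) | w.length = k i ∧ (A i ∩ square N w).Nonempty} with hB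
          rcases (A i).eq_empty_or_nonempty with he | hne
          · have : B = ∅ := by simp [hB, he]
            rw [this]
            simp
          have hBf : B.Finite := (List.finite_length_eq (Pos N) (k i)).subset fun w hw => hw.1
          calc ∑' w : B, ((N : ℝ≥0∞)⁻¹ ^ s) ^ w.1.length
              = ∑' w : B, ((N : ℝ≥0∞)⁻¹ ^ s) ^ k i := tsum_congr fun w => by rw [w.2.1]
            _ = B.encard * ((N : ℝ≥0∞)⁻¹ ^ s) ^ k i := ENNReal.tsum_set_const _ _
            _ ≤ 16 * ((N : ℝ≥0∞)⁻¹ ^ s) ^ k i := by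
                gcongr
                rw [← hBf.cast_ncard_eq]
                have h16 : B.ncard ≤ 16 := ncard_squares_le (k i) (hk1 i)
                exact_mod_cast h16
            _ ≤ 16 * (N : ℝ≥0∞) ^ s * ((⨆ _ : (A i).Nonempty, ediam (A i) ^ s) + ε' i) := by
                rw [mul_assoc]
                simp only [hne, iSup_pos]
                gcongr
                exact hk2 i
      _ ≤ 16 * (N : ℝ≥0∞) ^ s * (ε + ε) := by
          rw [ENNReal.tsum_mul_left, ENNReal.tsum_add]
          gcongr
      _ = 16 * (N : ℝ≥0∞) ^ s * 2 * ε := by rw [← two_mul, mul_assoc _ 2 ε]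
      _ < 1 := by
          have h := hε.trans_le (min_le_right _ _)
          rw [mul_comm]
          exact ENNReal.mul_lt_of_lt_div (by rwa [one_div])
  · obtain ⟨i, hi⟩ := mem_iUnion.1 (hSW hx)
    exact ⟨k i, fun w hw hxw => mem_iUnion.2 ⟨i, hw, x, hi, hxw⟩⟩

/-- The total weight of the squares of `C` contained in the square `u`. -/
noncomputable def coverWeight (C : Set (List (Pos N))) (s : ℝ) (u : List (Pos N)) : ℝ≥0∞ :=
  open Classical in ∑' w : C, if u <+: w.1 then ((N : ℝ≥0∞)⁻¹ ^ s) ^ w.1.length else 0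

theorem sum_coverWeight_le (C : Set (List (Pos N))) (s : ℝ) (u : List (Pos N))
    (F : Finset (Pos N)) : ∑ a ∈ F, coverWeight C s (u ++ [a]) ≤ coverWeight C s u := by
  classical
  simp only [coverWeight]
  rw [← Summable.tsum_finsetSum fun _ _ => ENNReal.summable]
  refine ENNReal.tsum_le_tsum fun w => ?_
  by_cases h : ∃ a ∈ F, u ++ [a] <+: w.1
  · obtain ⟨a, ha, haw⟩ := h
    rw [Finset.sum_eq_single_of_mem a ha, if_pos haw, if_pos ((List.prefix_append _ _).trans haw)]
    intro b _ hba
    refine if_neg fun hbw => hba ?_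
    have := List.prefix_of_prefix_length_le hbw haw (by simp)
    simpa using this
  · push Not at h
    rw [Finset.sum_eq_zero fun a ha => if_neg (h a ha)]
    exact zero_le

/-- A square that is not overloaded by the cover has fewer than `N ^ s` overloaded sub-squares. -/
theorem card_overloaded_lt (hN : 2 ≤ N) {s : ℝ} (hs : 0 < s) {C : Set (List (Pos N))}
    {u : List (Pos N)} (hu : coverWeight C s u < ((N : ℝ≥0∞)⁻¹ ^ s) ^ u.length)
    {F : Finset (Pos N)}
    (hF : ∀ a ∈ F, ((N : ℝ≥0∞)⁻¹ ^ s) ^ (u.length + 1) ≤ coverWeight C s (u ++ [a])) :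
    (F.card : ℝ) < (N : ℝ) ^ s := by
  have hN0 : (N : ℝ≥0∞) ≠ 0 := by simp; omega
  have hNt : (N : ℝ≥0∞) ≠ ∞ := ENNReal.natCast_ne_top N
  have hNs0 : (N : ℝ≥0∞) ^ s ≠ 0 := by
    simp [ENNReal.rpow_eq_zero_iff, hs.not_gt]; omega
  have hNst : (N : ℝ≥0∞) ^ s ≠ ∞ := ENNReal.rpow_ne_top_of_nonneg hs.le hNt
  set q : ℝ≥0∞ := (N : ℝ≥0∞)⁻¹ ^ s with hq
  have hqi : q = ((N : ℝ≥0∞) ^ s)⁻¹ := ENNReal.inv_rpow _ _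
  have h1 : (F.card : ℝ≥0∞) * q ^ (u.length + 1) < q ^ u.length := by
    refine lt_of_le_of_lt ?_ hu
    rw [← nsmul_eq_mul]
    exact (Finset.card_nsmul_le_sum F _ _ hF).trans (sum_coverWeight_le C s u F)
  have h2 : (F.card : ℝ≥0∞) < (N : ℝ≥0∞) ^ s := by
    by_contra hle
    refine h1.not_ge ?_
    calc q ^ u.length = (N : ℝ≥0∞) ^ s * q ^ (u.length + 1) := by
          rw [pow_succ', ← mul_assoc, hqi, ENNReal.mul_inv_cancel hNs0 hNst, one_mul]
      _ ≤ _ := by gcongr; exact not_lt.1 hle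
  have h3 := (ENNReal.toReal_lt_toReal (by simp) hNst).2 h2
  rwa [ENNReal.toReal_natCast, ← ENNReal.toReal_rpow, ENNReal.toReal_natCast] at h3

open Classical in
/-- If every good square has at most one bad sub-square, then the limit of the good squares is not
zero-dimensional modulo `s`: a separator of the left and the right side of vanishing
`s`-dimensional measure can be removed by discarding fewer than `N ^ s` further sub-squares in
every square that is left. -/
theorem not_isZeroDimMod_of_card_le_one {s : ℝ} (hs : 0 < s)
    (hNs : 2 * (1 + (N : ℝ) ^ s) < N) {G : List (Pos N) → Prop} (h0 : G [])
    (hG : ∀ u, G u → (Finset.univ.filter fun a : Pos N => ¬ G (u ++ [a])).card ≤ 1)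
    {M : Set (EuclideanSpace ℝ (Fin 2))}
    (hM : ∀ x, (∀ k, ∃ w : List (Pos N), w.length = k ∧ x ∈ square N w ∧ ∀ v, v <+: w → G v) →
      x ∈ M) : ¬ IsZeroDimMod s M := by
  rintro ⟨K, hK1, hK2, hK3⟩
  have hN : 2 ≤ N := by
    have h1 : (0 : ℝ) ≤ (N : ℝ) ^ s := by positivity
    have h2 : (2 : ℝ) < N := by linarith
    exact_mod_cast h2.le
  have : NeZero N := ⟨by omega⟩
  have hcont : ∀ c : Fin 2, Continuous fun x : EuclideanSpace ℝ (Fin 2) => x c :=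
    fun c => by fun_prop
  obtain ⟨U, V, hU, hV, hPU, hQV, hKUV, hUV⟩ := exists_separation_of_iUnion
    (A := {x : EuclideanSpace ℝ (Fin 2) | x 0 = 0}) (B := {x | x 0 = 1})
    (isClosed_eq (hcont 0) continuous_const) (isClosed_eq (hcont 0) continuous_const)
    (disjoint_left.2 fun x hx hy => zero_ne_one ((show x 0 = 0 from hx).symm.trans hy)) hK1 hK2
  have hnull : μH[s] (M \ (U ∪ V)) = 0 :=
    measure_mono_null (sdiff_subset_sdiff_right hKUV) hK3
  obtain ⟨C, hC1, hC2⟩ := exists_square_cover hN hs hnull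
  let G' : List (Pos N) → Prop := fun u =>
    G u ∧ coverWeight C s u < ((N : ℝ≥0∞)⁻¹ ^ s) ^ u.length
  have hG' : ∀ u, G' u → 2 * (Finset.univ.filter fun a : Pos N => ¬ G' (u ++ [a])).card < N := by
    rintro u ⟨hu1, hu2⟩
    have h1 := hG u hu1
    have h2 := card_overloaded_lt hN hs hu2
      (F := Finset.univ.filter fun a : Pos N =>
        ((N : ℝ≥0∞)⁻¹ ^ s) ^ (u.length + 1) ≤ coverWeight C s (u ++ [a])) (by simp)
    have h3 : (Finset.univ.filter fun a : Pos N => ¬ G' (u ++ [a])) ⊆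
        (Finset.univ.filter fun a : Pos N => ¬ G (u ++ [a])) ∪
        (Finset.univ.filter fun a : Pos N =>
          ((N : ℝ≥0∞)⁻¹ ^ s) ^ (u.length + 1) ≤ coverWeight C s (u ++ [a])) := by
      intro a ha
      simp only [G', Finset.mem_filter, Finset.mem_univ, true_and, Finset.mem_union,
        List.length_append, List.length_singleton] at ha ⊢
      by_contra! hno
      exact ha ⟨hno.1, hno.2⟩
    have h4 := (Finset.card_le_card h3).trans (Finset.card_union_le _ _)
    have h5 : ((Finset.univ.filter fun a : Pos N => ¬ G' (u ++ [a])).card : ℝ) ≤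
        1 + (Finset.univ.filter fun a : Pos N =>
          ((N : ℝ≥0∞)⁻¹ ^ s) ^ (u.length + 1) ≤ coverWeight C s (u ++ [a])).card := by
      exact_mod_cast h4.trans (by omega)
    have h6 : (2 : ℝ) * ((Finset.univ.filter fun a : Pos N => ¬ G' (u ++ [a])).card : ℝ) < N := by
      linarith
    exact_mod_cast h6
  have hG0 : G' [] := by
    refine ⟨h0, ?_⟩
    simpa [coverWeight] using hC1
  obtain ⟨x, hxUV, hx⟩ := exists_notMem_of_separation (fun u hu => by convert hG' u hu) hG0
    hU hV hUV hPU hQV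
  have hxM : x ∈ M := hM x fun k => by
    obtain ⟨w, h1, h2, h3⟩ := hx k
    exact ⟨w, h1, h2, fun v hv => (h3 v hv).1⟩
  obtain ⟨k, hk⟩ := hC2 x ⟨hxM, hxUV⟩
  obtain ⟨w, h1, h2, h3⟩ := hx k
  refine (h3 w List.prefix_rfl).2.not_ge ?_
  refine le_trans ?_ (ENNReal.le_tsum (⟨w, hk w h1 h2⟩ : C))
  simp

end Covering

/-! ### Choices that are good in steps of several levels -/

section BlockGood

variable {n : ℕ}

/-- Goodness of depth `m`, in steps of `j` levels: all the squares of the first `j` levels are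
kept, and at most one of the squares of level `j` fails to be good of depth `m - 1`. -/
def BlockGood (j : ℕ) : ℕ → Set (List (Pos n) × Pos n) → Prop
  | 0, _ => True
  | m + 1, K => (∀ v a, v.length < j → (v, a) ∈ K) ∧
      ∀ v w : List (Pos n), v.length = j → w.length = j → v ≠ w →
        BlockGood j m (shift K v) ∨ BlockGood j m (shift K w)

theorem BlockGood.of_succ {j m : ℕ} {K : Set (List (Pos n) × Pos n)} (h : BlockGood j (m + 1) K) :
    BlockGood j m K := by
  induction m generalizing K with
  | zero => trivial
  | succ m ih => exact ⟨h.1, fun v w hv hw hvw => (h.2 v w hv hw hvw).imp ih ih⟩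

theorem BlockGood.of_le {j m l : ℕ} {K : Set (List (Pos n) × Pos n)} (h : BlockGood j m K)
    (hl : l ≤ m) : BlockGood j l K := by
  induction hl with
  | refl => exact h
  | step _ ih => exact ih h.of_succ

theorem eq_of_not_forall_blockGood {j : ℕ} {K : Set (List (Pos n) × Pos n)}
    (h : ∀ m, BlockGood j m K) {v w : List (Pos n)} (hv : v.length = j) (hw : w.length = j)
    (hbv : ¬ ∀ m, BlockGood j m (shift K v)) (hbw : ¬ ∀ m, BlockGood j m (shift K w)) : v = w := by
  by_contra hvw
  push Not at hbv hbw
  obtain ⟨m, hm⟩ := hbv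
  obtain ⟨l, hl⟩ := hbw
  rcases (h (max m l + 1)).2 v w hv hw hvw with h1 | h1
  · exact hm (h1.of_le (le_max_left _ _))
  · exact hl (h1.of_le (le_max_right _ _))

theorem retained_of_length_le {j : ℕ} {K : Set (List (Pos n) × Pos n)}
    (h : ∀ v a, v.length < j → (v, a) ∈ K) {w : List (Pos n)} (hw : w.length ≤ j) :
    Retained K w := by
  intro u a hu
  have := hu.length_le
  rw [List.length_append, List.length_singleton] at this
  exact h u a (by omega)

/-- The squares of the `n ^ j`-adic grid are the squares of the `n`-adic grid whose level is a
multiple of `j`. -/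
theorem square_flatMap_eq [NeZero n] {j : ℕ} {e : Pos (n ^ j) → List (Pos n)}
    (hlen : ∀ a, (e a).length = j) (hidx : ∀ a c, cornerIndex n (e a) c = a c)
    (w : List (Pos (n ^ j))) : square n (w.flatMap e) = square (n ^ j) w := by
  have hl : ∀ w : List (Pos (n ^ j)), (w.flatMap e).length = j * w.length := by
    intro w
    induction w with
    | nil => simp
    | cons a w ih =>
      rw [List.flatMap_cons, List.length_append, ih, hlen, List.length_cons]
      ring
  have happ : ∀ (u v : List (Pos n)) c,
      cornerIndex n (u ++ v) c = cornerIndex n u c * n ^ v.length + cornerIndex n v c := by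
    intro u v c
    induction u with
    | nil => simp [cornerIndex]
    | cons a u ih =>
      rw [List.cons_append, cornerIndex, cornerIndex, ih, List.length_append, pow_add]
      ring
  have hi : ∀ (w : List (Pos (n ^ j))) c,
      cornerIndex n (w.flatMap e) c = cornerIndex (n ^ j) w c := by
    intro w c
    induction w with
    | nil => rfl
    | cons a w ih =>
      rw [List.flatMap_cons, happ, ih, hidx, cornerIndex, hl, pow_mul]
  ext x
  refine forall_congr' fun c => ?_
  rw [corner_eq_div, corner_eq_div, hi, hl, pow_mul, Nat.cast_pow]

theorem exists_block_words (n j : ℕ) : ∃ e : Pos (n ^ j) → List (Pos n),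
    (∀ a, (e a).length = j) ∧ ∀ a c, cornerIndex n (e a) c = a c := by
  have h := fun a : Pos (n ^ j) => exists_cornerIndex_eq n j (fun c => a c) fun c => (a c).2
  choose e h1 h2 using h
  exact ⟨e, h1, fun a c => congrFun (h2 a) c⟩

/-- Goodness of all depths forces the limit set to have large dimension. -/
theorem not_isZeroDimMod_of_blockGood [NeZero n] {j : ℕ} {s : ℝ} (hs : 0 < s)
    (hj : 2 * (1 + ((n ^ j : ℕ) : ℝ) ^ s) < (n ^ j : ℕ)) {K : Set (List (Pos n) × Pos n)}
    (hK : ∀ m, BlockGood j m K) : ¬ IsZeroDimMod s (limitSet K) := by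
  obtain ⟨e, hlen, hidx⟩ := exists_block_words n j
  have hj1 : 1 ≤ j := by
    rcases Nat.eq_zero_or_pos j with rfl | h
    · norm_num at hj
    · exact h
  have hinj : Function.Injective e := fun a b hab =>
    funext fun c => Fin.ext (by rw [← hidx, ← hidx, hab])
  classical
  refine not_isZeroDimMod_of_card_le_one hs hj
    (G := fun U => ∀ m, BlockGood j m (shift K (U.flatMap e))) hK ?_ ?_
  · intro U hU
    refine Finset.card_le_one.2 fun a ha b hb => hinj ?_
    simp only [Finset.mem_filter, Finset.mem_univ, true_and, List.flatMap_append,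
      List.flatMap_singleton, shift_append] at ha hb
    exact eq_of_not_forall_blockGood hU (hlen a) (hlen b) ha hb
  · have hret : ∀ (W : List (Pos (n ^ j))) (K : Set (List (Pos n) × Pos n)),
        (∀ v, v <+: W → ∀ m, BlockGood j m (shift K (v.flatMap e))) →
          Retained K (W.flatMap e) ∧ W.length ≤ (W.flatMap e).length := by
      intro W
      induction W with
      | nil => exact fun K _ => ⟨retained_nil K, by simp⟩
      | cons a W ih =>
        intro K h
        obtain ⟨h1, h2⟩ := ih (shift K (e a)) fun v hv m => by
          have := h (a :: v) (by simpa using hv) m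
          rwa [List.flatMap_cons, shift_append] at this
        rw [List.flatMap_cons, retained_append, List.length_append, hlen, List.length_cons]
        exact ⟨⟨retained_of_length_le (h [] List.nil_prefix 1).1 (hlen a).le, h1⟩, by omega⟩
    intro x hx
    rw [limitSet_eq_iInter]
    refine mem_iInter.2 fun k => ?_
    obtain ⟨W, hW, hxW, hpre⟩ := hx k
    obtain ⟨h1, h2⟩ := hret W K hpre
    refine antitone_level K (hW ▸ h2) (mem_level.2 ⟨W.flatMap e, rfl, h1, ?_⟩)
    rwa [square_flatMap_eq hlen hidx]

theorem exists_block_length (hn : 2 ≤ n) {s : ℝ} (hs : s < 1) :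
    ∃ j : ℕ, 2 * (1 + ((n ^ j : ℕ) : ℝ) ^ s) < (n ^ j : ℕ) := by
  have hn0 : (0 : ℝ) < n := by exact_mod_cast (by omega : 0 < n)
  have hn1 : (1 : ℝ) < n := by exact_mod_cast (by omega : 1 < n)
  have h1 : Tendsto (fun j : ℕ => ((n : ℝ)⁻¹) ^ j) atTop (𝓝 0) :=
    tendsto_pow_atTop_nhds_zero_of_lt_one (by positivity) (inv_lt_one_of_one_lt₀ hn1)
  have h2 : Tendsto (fun j : ℕ => ((n : ℝ) ^ (s - 1)) ^ j) atTop (𝓝 0) :=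
    tendsto_pow_atTop_nhds_zero_of_lt_one (by positivity)
      (Real.rpow_lt_one_of_one_lt_of_neg hn1 (by linarith))
  have h3 := (h1.add h2).const_mul 2
  rw [add_zero, mul_zero] at h3
  obtain ⟨j, hj⟩ := (h3.eventually_lt_const one_pos).exists
  refine ⟨j, ?_⟩
  have hp : (0 : ℝ) < (n : ℝ) ^ j := by positivity
  have h4 := mul_lt_mul_of_pos_right hj hp
  have h5 : ((n : ℝ)⁻¹) ^ j * (n : ℝ) ^ j = 1 := by
    rw [← mul_pow, inv_mul_cancel₀ hn0.ne', one_pow]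
  have h6 : ((n : ℝ) ^ (s - 1)) ^ j * (n : ℝ) ^ j = ((n : ℝ) ^ j) ^ s := by
    rw [← mul_pow, ← Real.rpow_add_one hn0.ne', sub_add_cancel, ← Real.rpow_natCast,
      ← Real.rpow_natCast, ← Real.rpow_mul hn0.le, ← Real.rpow_mul hn0.le, mul_comm]
  push_cast
  linarith

theorem measurableSet_blockGood (j m : ℕ) :
    MeasurableSet {K : Set (List (Pos n) × Pos n) | BlockGood j m K} := by
  induction m with
  | zero => simp [BlockGood]
  | succ m ih =>
    simp only [BlockGood, ofPred_and, ofPred_forall, ofPred_or]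
    refine .inter (.iInter fun v => .iInter fun a => .iInter fun _ =>
      measurableSet_setOfPred.2 (measurable_set_mem (v, a))) ?_
    exact .iInter fun v => .iInter fun w => .iInter fun _ => .iInter fun _ => .iInter fun _ =>
      (measurable_shift v ih).union (measurable_shift w ih)

end BlockGood

/-! ### The law of the choices and independence -/

section Law

variable {n : ℕ} {Ω : Type*}

/-- The random choice determined by the events that the sub-squares are kept. -/
def choices (keep : List (Pos n) × Pos n → Set Ω) (ω : Ω) : Set (List (Pos n) × Pos n) :=
  {q | ω ∈ keep q}

/-- The events of the percolation inside the square `w`. -/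
def shiftKeep (keep : List (Pos n) × Pos n → Set Ω) (w : List (Pos n)) :
    List (Pos n) × Pos n → Set Ω :=
  fun q => keep (w ++ q.1, q.2)

/-- The indices of the choices made inside the square `w`. -/
def below (w : List (Pos n)) : Set (List (Pos n) × Pos n) :=
  range fun q : List (Pos n) × Pos n => (w ++ q.1, q.2)

/-- The σ-algebra generated by the events with indices in `S`. -/
abbrev keepAlgebra (keep : List (Pos n) × Pos n → Set Ω) (S : Set (List (Pos n) × Pos n)) :
    MeasurableSpace Ω :=
  ⨆ q ∈ S, MeasurableSpace.generateFrom {keep q}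

theorem measurableSet_keepAlgebra {keep : List (Pos n) × Pos n → Set Ω}
    {S : Set (List (Pos n) × Pos n)} {q : List (Pos n) × Pos n} (hq : q ∈ S) :
    MeasurableSet[keepAlgebra keep S] (keep q) :=
  le_iSup₂ (f := fun q (_ : q ∈ S) => MeasurableSpace.generateFrom {keep q}) q hq _
    (MeasurableSpace.measurableSet_generateFrom (mem_singleton _))

theorem keepAlgebra_mono (keep : List (Pos n) × Pos n → Set Ω) {S T : Set (List (Pos n) × Pos n)}
    (h : S ⊆ T) : keepAlgebra keep S ≤ keepAlgebra keep T :=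
  biSup_mono h

theorem measurableSet_keepAlgebra_shift {keep : List (Pos n) × Pos n → Set Ω} (w : List (Pos n))
    {B : Set (Set (List (Pos n) × Pos n))} (hB : MeasurableSet B) :
    MeasurableSet[keepAlgebra keep (below w)] {ω | shift (choices keep ω) w ∈ B} := by
  have h : Measurable[keepAlgebra keep (below w)] fun ω => shift (choices keep ω) w := by
    refine (@measurable_set_iff _ _ (keepAlgebra keep (below w)) _).2 fun q => ?_
    exact (@measurableSet_setOfPred _ (keepAlgebra keep (below w)) _).1
      (measurableSet_keepAlgebra (mem_range_self q))
  exact h hB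

variable [MeasurableSpace Ω] {P : Measure Ω} {p : ℝ}
  {keep : List (Pos n) × Pos n → Set Ω}

theorem IsPercolation.measurable_choices (h : IsPercolation P p keep) :
    Measurable (choices keep) :=
  measurable_set_iff.2 fun q => measurableSet_setOfPred.1 (h.measurableSet q)

theorem IsPercolation.shiftKeep (h : IsPercolation P p keep) (w : List (Pos n)) :
    IsPercolation P p (shiftKeep keep w) where
  measurableSet q := h.measurableSet _
  indep := h.indep.precomp (g := fun q : List (Pos n) × Pos n => (w ++ q.1, q.2))
    fun q r hqr => by simpa [Prod.ext_iff] using hqr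
  prob q := h.prob _

theorem IsPercolation.measure_inter (h : IsPercolation P p keep)
    {S T : Set (List (Pos n) × Pos n)} (hST : Disjoint S T) {A B : Set Ω}
    (hA : MeasurableSet[keepAlgebra keep S] A) (hB : MeasurableSet[keepAlgebra keep T] B) :
    P (A ∩ B) = P A * P B := by
  refine (Indep_iff _ _ _).1 (indep_iSup_of_disjoint (fun q => ?_)
    ((iIndepSet_iff_iIndep _ _).1 h.indep) hST) A B hA hB
  exact MeasurableSpace.generateFrom_le fun A hA => (mem_singleton_iff.1 hA) ▸ h.measurableSet q

theorem IsPercolation.keepAlgebra_le (h : IsPercolation P p keep)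
    (S : Set (List (Pos n) × Pos n)) : keepAlgebra keep S ≤ ‹MeasurableSpace Ω› :=
  iSup₂_le fun q _ => MeasurableSpace.generateFrom_le fun _ hA =>
    (mem_singleton_iff.1 hA) ▸ h.measurableSet q

theorem IsPercolation.map_choices_apply (h : IsPercolation P p keep)
    (F : Finset (List (Pos n) × Pos n)) :
    P.map (choices keep) {K | ∀ q ∈ F, q ∈ K} = ∏ _q ∈ F, ENNReal.ofReal p := by
  have hm : MeasurableSet {K : Set (List (Pos n) × Pos n) | ∀ q ∈ F, q ∈ K} := by
    simp only [ofPred_forall]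
    exact .iInter fun q => .iInter fun _ => measurableSet_mem q
  rw [Measure.map_apply h.measurable_choices hm]
  have : choices keep ⁻¹' {K | ∀ q ∈ F, q ∈ K} = ⋂ q ∈ F, keep q := by
    ext ω
    simp [choices]
  rw [this, (iIndepSet_iff _ _).1 h.indep F fun q _ =>
    MeasurableSpace.measurableSet_generateFrom (mem_singleton _)]
  exact Finset.prod_congr rfl fun q _ => h.prob q

/-- The law of the choices is determined by the retention probability. -/
theorem IsPercolation.map_choices_eq (h : IsPercolation P p keep) [IsProbabilityMeasure P]
    {Ω' : Type*} [MeasurableSpace Ω'] {P' : Measure Ω'} [IsProbabilityMeasure P']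
    {keep' : List (Pos n) × Pos n → Set Ω'} (h' : IsPercolation P' p keep') :
    P.map (choices keep) = P'.map (choices keep') := by
  classical
  have := Measure.isProbabilityMeasure_map (μ := P) h.measurable_choices.aemeasurable
  have := Measure.isProbabilityMeasure_map (μ := P') h'.measurable_choices.aemeasurable
  refine ext_of_generate_finite
    (range fun F : Finset (List (Pos n) × Pos n) => {K | ∀ q ∈ F, q ∈ K}) ?_ ?_ ?_ (by simp)
  · refine le_antisymm ?_ (MeasurableSpace.generateFrom_le ?_)
    · have hid : Measurable[MeasurableSpace.generateFrom
          (range fun F : Finset (List (Pos n) × Pos n) => {K | ∀ q ∈ F, q ∈ K})]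
          (id : Set (List (Pos n) × Pos n) → Set (List (Pos n) × Pos n)) := by
        refine (@measurable_set_iff _ _ (MeasurableSpace.generateFrom _) _).2 fun q => ?_
        refine (@measurableSet_setOfPred _ (MeasurableSpace.generateFrom _) _).1 ?_
        exact MeasurableSpace.measurableSet_generateFrom ⟨{q}, by simp⟩
      exact fun A hA => hid hA
    · rintro _ ⟨F, rfl⟩
      simp only [ofPred_forall]
      exact .iInter fun q => .iInter fun _ => measurableSet_mem q
  · rintro _ ⟨F, rfl⟩ _ ⟨F', rfl⟩ -
    refine ⟨F ∪ F', ?_⟩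
    ext K
    simp only [Finset.mem_union, mem_inter_iff, mem_ofPred_eq]
    exact ⟨fun h => ⟨fun q hq => h q (Or.inl hq), fun q hq => h q (Or.inr hq)⟩,
      fun h q hq => hq.elim (h.1 q) (h.2 q)⟩
  · rintro _ ⟨F, rfl⟩
    exact (h.map_choices_apply F).trans (h'.map_choices_apply F).symm

theorem IsPercolation.measure_choices_eq (h : IsPercolation P p keep) [IsProbabilityMeasure P]
    {Ω' : Type*} [MeasurableSpace Ω'] {P' : Measure Ω'} [IsProbabilityMeasure P']
    {keep' : List (Pos n) × Pos n → Set Ω'} (h' : IsPercolation P' p keep')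
    {B : Set (Set (List (Pos n) × Pos n))} (hB : MeasurableSet B) :
    P {ω | choices keep ω ∈ B} = P' {ω | choices keep' ω ∈ B} := by
  have : P.map (choices keep) B = P'.map (choices keep') B := by rw [h.map_choices_eq h']
  rwa [Measure.map_apply h.measurable_choices hB,
    Measure.map_apply h'.measurable_choices hB] at this

theorem IsPercolation.measure_shift_eq (h : IsPercolation P p keep) [IsProbabilityMeasure P]
    (w : List (Pos n)) {B : Set (Set (List (Pos n) × Pos n))} (hB : MeasurableSet B) :
    P {ω | shift (choices keep ω) w ∈ B} = P {ω | choices keep ω ∈ B} :=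
  (h.shiftKeep w).measure_choices_eq h hB

end Law

/-! ### Fixed points of the generating function -/

section FixedPoint

variable {n : ℕ} {Ω : Type*} [MeasurableSpace Ω] {P : Measure Ω} [IsProbabilityMeasure P] {p : ℝ}
  {keep : List (Pos n) × Pos n → Set Ω}

/-- The probability of an event inherited from all kept squares of the first level is a fixed point
of the generating function of the offspring distribution. -/
theorem IsPercolation.measureReal_eq_pow (h : IsPercolation P p keep) (hp : 0 ≤ p)
    {B : Set (Set (List (Pos n) × Pos n))} (hB : MeasurableSet B)
    (hrec : ∀ K, K ∈ B ↔ ∀ a, ([], a) ∈ K → shift K [a] ∈ B) :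
    P.real {ω | choices keep ω ∈ B} =
      (1 - p * (1 - P.real {ω | choices keep ω ∈ B})) ^ Fintype.card (Pos n) := by
  classical
  let T : Pos n → Set (List (Pos n) × Pos n) := fun a => insert ([], a) (below [a])
  let E : Pos n → Set Ω := fun a => (keep ([], a) ∩ {ω | shift (choices keep ω) [a] ∈ B}ᶜ)ᶜ
  have hk : ∀ a, MeasurableSet[keepAlgebra keep (T a)] (keep ([], a)) := fun a =>
    measurableSet_keepAlgebra (mem_insert _ _)
  have hs : ∀ a, MeasurableSet[keepAlgebra keep (T a)]
      {ω | shift (choices keep ω) [a] ∈ B} := fun a =>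
    keepAlgebra_mono keep (subset_insert _ _) _ (measurableSet_keepAlgebra_shift [a] hB)
  have hE : ∀ a, MeasurableSet[keepAlgebra keep (T a)] (E a) := fun a =>
    ((hk a).inter (hs a).compl).compl
  have hT : ∀ a b, a ≠ b → Disjoint (T a) (T b) := by
    intro a b hab
    rw [Set.disjoint_left]
    rintro q (rfl | ⟨r, rfl⟩) (h' | ⟨r', h'⟩) <;> simp [Prod.ext_iff] at h'
    · exact hab h'
    · exact hab h'.1.1.symm
  -- the events belonging to different squares of the first level are independent
  have hprod : ∀ F : Finset (Pos n), P (⋂ a ∈ F, E a) = ∏ a ∈ F, P (E a) := by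
    intro F
    induction F using Finset.induction_on with
    | empty => simp
    | insert a F ha ih =>
      rw [Finset.set_biInter_insert, Finset.prod_insert ha, ← ih]
      refine h.measure_inter (S := T a) (T := ⋃ b ∈ F, T b) ?_ (hE a) ?_
      · simp only [disjoint_iUnion_right]
        exact fun b hb => hT a b fun hab => ha (hab ▸ hb)
      · refine @Finset.measurableSet_biInter _ _ (keepAlgebra keep (⋃ b ∈ F, T b)) _ F
          fun b hb => ?_
        exact keepAlgebra_mono keep (subset_biUnion_of_mem (u := T) hb) _ (hE b)
  have hB' : {ω | choices keep ω ∈ B} = ⋂ a ∈ (Finset.univ : Finset (Pos n)), E a := by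
    ext ω
    rw [mem_ofPred_eq, hrec]
    simp [E, choices]
  have hEa : ∀ a, P.real (E a) = 1 - p * (1 - P.real {ω | choices keep ω ∈ B}) := by
    intro a
    have h1 : P (keep ([], a) ∩ {ω | shift (choices keep ω) [a] ∈ B}ᶜ) =
        P (keep ([], a)) * P ({ω | shift (choices keep ω) [a] ∈ B}ᶜ) := by
      refine h.measure_inter (S := {([], a)})
        (T := below [a]) ?_
        (measurableSet_keepAlgebra (mem_singleton _))
        (measurableSet_keepAlgebra_shift [a] hB).compl
      rw [Set.disjoint_left]
      rintro _ rfl ⟨r, hr⟩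
      simp at hr
    have h2 := h.keepAlgebra_le _ _ (hs a)
    rw [probReal_compl_eq_one_sub ((h.measurableSet _).inter h2.compl), measureReal_def, h1,
      ENNReal.toReal_mul, h.prob, ENNReal.toReal_ofReal hp, ← measureReal_def,
      probReal_compl_eq_one_sub h2, measureReal_def, h.measure_shift_eq [a] hB, ← measureReal_def]
  conv_lhs => rw [hB', measureReal_def, hprod, ENNReal.toReal_prod]
  simp only [← measureReal_def, hEa, Finset.prod_const, Finset.card_univ]

/-- By strict convexity the generating function has at most one fixed point below `1`. -/
theorem eq_of_fixedPoint {k : ℕ} (hk : 2 ≤ k) {p x y : ℝ} (hp0 : 0 < p) (hp1 : p ≤ 1)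
    (hx0 : 0 ≤ x) (hx1 : x < 1) (hy0 : 0 ≤ y) (hy1 : y < 1)
    (hx : x = (1 - p * (1 - x)) ^ k) (hy : y = (1 - p * (1 - y)) ^ k) : x = y := by
  wlog hxy : x < y generalizing x y
  · rcases (not_lt.1 hxy).lt_or_eq with h | h
    · exact (this hy0 hy1 hx0 hx1 hy hx h).symm
    · exact h.symm
  exfalso
  have h1x : 0 < 1 - x := by linarith
  set t : ℝ := (y - x) / (1 - x) with ht
  have ht0 : 0 < t := div_pos (by linarith) h1x
  have ht1 : t < 1 := (div_lt_one h1x).2 (by linarith)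
  have hyt : y = (1 - t) * x + t := by
    rw [ht]
    field_simp
    ring
  have h := (strictConvexOn_pow hk).2 (x := 1 - p * (1 - x)) (y := 1)
    (show (0 : ℝ) ≤ _ by nlinarith) (show (0 : ℝ) ≤ 1 by norm_num)
    (by nlinarith : 1 - p * (1 - x) ≠ 1)
    (sub_pos.2 ht1) ht0 (by ring)
  simp only [smul_eq_mul, mul_one, one_pow, ← hx] at h
  have h2 : (1 - t) * (1 - p * (1 - x)) + t = 1 - p * (1 - y) := by
    rw [hyt]
    ring
  rw [h2, ← hy] at h
  linarith

/-- For a subcritical offspring distribution the only fixed point is `1`. -/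
theorem eq_one_of_fixedPoint {k : ℕ} {p x : ℝ} (hp0 : 0 ≤ p) (hp1 : p ≤ 1) (hkp : k * p < 1)
    (hx0 : 0 ≤ x) (hx1 : x ≤ 1) (hx : x = (1 - p * (1 - x)) ^ k) : x = 1 := by
  have h := one_add_mul_le_pow (show (-2 : ℝ) ≤ -(p * (1 - x)) by nlinarith) k
  rw [← sub_eq_add_neg, ← hx] at h
  nlinarith

end FixedPoint

/-! ### Coupling of all parameters -/

section Coupling

variable {n : ℕ}

/-- A probability space carrying the percolations of all parameters: independent uniform labels. -/
noncomputable def labelMeasure (n : ℕ) : Measure (List (Pos n) × Pos n → unitInterval) :=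
  Measure.infinitePi fun _ => volume

instance : IsProbabilityMeasure (labelMeasure n) := by
  unfold labelMeasure
  infer_instance

/-- In the percolation of parameter `p` the sub-squares with label less than `p` are kept. -/
def labelKeep (n : ℕ) (p : ℝ) (q : List (Pos n) × Pos n) :
    Set (List (Pos n) × Pos n → unitInterval) :=
  {u | (u q : ℝ) < p}

theorem isPercolation_labelKeep {p : ℝ} (hp0 : 0 ≤ p) (hp1 : p ≤ 1) :
    IsPercolation (labelMeasure n) p (labelKeep n p) := by
  have hm : ∀ q, MeasurableSet (labelKeep n p q) := fun q =>
    measurableSet_lt (measurable_subtype_coe.comp (measurable_pi_apply q)) measurable_const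
  have hpi : ∀ F : Finset (List (Pos n) × Pos n),
      labelMeasure n (⋂ q ∈ F, labelKeep n p q) = ∏ _q ∈ F, ENNReal.ofReal p := by
    intro F
    have : ⋂ q ∈ F, labelKeep n p q =
        Set.pi F fun _ => Iio (⟨p, hp0, hp1⟩ : unitInterval) := by
      ext u
      simp [labelKeep, Set.pi, ← Subtype.coe_lt_coe]
    rw [this, labelMeasure, Measure.infinitePi_pi _ fun _ _ => measurableSet_Iio]
    simp
  have hprob : ∀ q, labelMeasure n (labelKeep n p q) = ENNReal.ofReal p := fun q => by
    simpa using hpi {q}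
  refine ⟨hm, (iIndepSet_iff_meas_biInter hm).2 fun F => ?_, hprob⟩
  rw [hpi]
  exact Finset.prod_congr rfl fun q _ => (hprob q).symm

theorem choices_labelKeep_mono {p p' : ℝ} (h : p ≤ p')
    (u : List (Pos n) × Pos n → unitInterval) :
    choices (labelKeep n p) u ⊆ choices (labelKeep n p') u :=
  fun _ hq => lt_of_lt_of_le (show _ < p from hq) h

end Coupling

/-! ### Retention probabilities close to one -/

section Supercritical

variable {n : ℕ} {Ω : Type*} [MeasurableSpace Ω] {P : Measure Ω} [IsProbabilityMeasure P] {p : ℝ}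
  {keep : List (Pos n) × Pos n → Set Ω}

/-- A square is not good of depth `m + 1` if a square of its first `j` levels is missing, or if two
of its squares of level `j` are not good of depth `m`. -/
theorem IsPercolation.measureReal_not_blockGood_succ_le (h : IsPercolation P p keep) (hp0 : 0 ≤ p)
    (j m : ℕ) :
    P.real {ω | ¬ BlockGood j (m + 1) (choices keep ω)} ≤
      ((List.finite_length_lt (Pos n) j).toFinset ×ˢ (Finset.univ : Finset (Pos n))).card *
          (1 - p) +
        ((List.finite_length_eq (Pos n) j).toFinset ×ˢ
          (List.finite_length_eq (Pos n) j).toFinset).card *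
          P.real {ω | ¬ BlockGood j m (choices keep ω)} ^ 2 := by
  classical
  set L := (List.finite_length_eq (Pos n) j).toFinset with hL
  set F := (List.finite_length_lt (Pos n) j).toFinset ×ˢ (Finset.univ : Finset (Pos n)) with hF
  set x := P.real {ω | ¬ BlockGood j m (choices keep ω)} with hx
  have hB : MeasurableSet {K : Set (List (Pos n) × Pos n) | ¬ BlockGood j m K} :=
    (measurableSet_blockGood j m).compl
  have hsub : {ω | ¬ BlockGood j (m + 1) (choices keep ω)} ⊆
      (⋃ q ∈ F, (keep q)ᶜ) ∪ ⋃ vw ∈ (L ×ˢ L).filter fun vw => vw.1 ≠ vw.2,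
        ({ω | ¬ BlockGood j m (shift (choices keep ω) vw.1)} ∩
          {ω | ¬ BlockGood j m (shift (choices keep ω) vw.2)}) := by
    intro ω hω
    by_contra hno
    simp only [mem_union, mem_iUnion, not_or, not_exists] at hno
    refine hω ⟨fun v a hv => ?_, fun v w hv hw hvw => ?_⟩
    · by_contra hva
      exact hno.1 (v, a) (by simpa [hF] using hv) hva
    · by_contra! hcon
      exact hno.2 (v, w) (by simp [hL, hv, hw, hvw]) ⟨hcon.1, hcon.2⟩
  refine (measureReal_mono hsub).trans ((measureReal_union_le _ _).trans (add_le_add ?_ ?_))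
  · refine (measureReal_biUnion_finset_le _ _).trans ?_
    rw [← nsmul_eq_mul]
    refine Finset.sum_le_card_nsmul _ _ _ fun q _ => ?_
    rw [probReal_compl_eq_one_sub (h.measurableSet q), measureReal_def, h.prob,
      ENNReal.toReal_ofReal hp0]
  · refine (measureReal_biUnion_finset_le _ _).trans ?_
    refine (Finset.sum_le_card_nsmul _ _ (x ^ 2) fun vw hvw => ?_).trans ?_
    · obtain ⟨v, w⟩ := vw
      simp only [Finset.mem_filter, Finset.mem_product, hL, Finite.mem_toFinset,
        mem_ofPred_eq] at hvw
      have hind := h.measure_inter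
        (S := below v) (T := below w) (by
          rw [Set.disjoint_left]
          rintro _ ⟨r, rfl⟩ ⟨r', hr'⟩
          simp only [Prod.mk.injEq] at hr'
          exact hvw.2 (List.append_inj_left hr'.1 (hvw.1.2.trans hvw.1.1.symm)).symm)
        (measurableSet_keepAlgebra_shift v hB)
        (measurableSet_keepAlgebra_shift w hB)
      rw [h.measure_shift_eq v hB, h.measure_shift_eq w hB] at hind
      rw [hx, sq, measureReal_def, measureReal_def, ← ENNReal.toReal_mul]
      exact le_of_eq (congrArg ENNReal.toReal hind)
    · rw [nsmul_eq_mul]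
      gcongr
      exact Finset.filter_subset _ _

/-- For retention probabilities close to `1`, goodness of all depths has positive probability. -/
theorem exists_retention_blockGood (n j : ℕ) : ∃ p₁ : ℝ, 0 < p₁ ∧ p₁ < 1 ∧
    labelMeasure n {u | ∀ m, BlockGood j m (choices (labelKeep n p₁) u)} ≠ 0 := by
  set E : ℝ := (((List.finite_length_lt (Pos n) j).toFinset ×ˢ
    (Finset.univ : Finset (Pos n))).card : ℝ) with hE
  set c : ℝ := (((List.finite_length_eq (Pos n) j).toFinset ×ˢ
    (List.finite_length_eq (Pos n) j).toFinset).card : ℝ) with hc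
  have hE0 : 0 ≤ E := Nat.cast_nonneg _
  have hc0 : 0 ≤ c := Nat.cast_nonneg _
  -- with failure probability `η` for the first `j` levels, `2 * η` bounds the probability of
  -- failure at every depth, as `η + c * (2 * η) ^ 2 ≤ 2 * η`
  set η : ℝ := 1 / (4 * (c + 1)) with hη
  have hη0 : 0 < η := by positivity
  have hη1 : η ≤ 1 / 4 := by
    rw [hη]
    exact one_div_le_one_div_of_le (by norm_num) (by linarith)
  have hcη : 4 * c * η ≤ 1 := by
    rw [hη, mul_one_div, div_le_one (by positivity)]
    linarith
  set p₁ : ℝ := 1 - η / (E + 1) with hp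
  have hq0 : 0 < η / (E + 1) := by positivity
  have hq1 : η / (E + 1) ≤ η := div_le_self hη0.le (by linarith)
  have hEq : E * (1 - p₁) ≤ η := by
    rw [hp, sub_sub_cancel, mul_div_assoc', div_le_iff₀ (by linarith)]
    nlinarith
  refine ⟨p₁, by linarith, by linarith, ?_⟩
  have h := isPercolation_labelKeep (n := n) (p := p₁) (by linarith) (by linarith)
  have hbound : ∀ m, (labelMeasure n).real
      {u | ¬ BlockGood j m (choices (labelKeep n p₁) u)} ≤ 2 * η := by
    intro m
    induction m with
    | zero => simp [BlockGood, hη0.le]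
    | succ m ih =>
      refine (h.measureReal_not_blockGood_succ_le (by linarith) j m).trans ?_
      rw [← hE, ← hc]
      have h2 : (labelMeasure n).real
          {u | ¬ BlockGood j m (choices (labelKeep n p₁) u)} ^ 2 ≤ (2 * η) ^ 2 :=
        pow_le_pow_left₀ measureReal_nonneg ih 2
      have h3 := mul_le_mul_of_nonneg_left h2 hc0
      nlinarith
  intro hnull
  have hmono : Monotone fun m => {u | ¬ BlockGood j m (choices (labelKeep n p₁) u)} :=
    fun m l hml u hu hl => hu (hl.of_le hml)
  have hU : labelMeasure n (⋃ m, {u | ¬ BlockGood j m (choices (labelKeep n p₁) u)}) ≤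
      ENNReal.ofReal (2 * η) := by
    rw [hmono.measure_iUnion]
    refine iSup_le fun m => ?_
    rw [← ofReal_measureReal]
    exact ENNReal.ofReal_le_ofReal (hbound m)
  have hcov : (univ : Set (List (Pos n) × Pos n → unitInterval)) ⊆
      {u | ∀ m, BlockGood j m (choices (labelKeep n p₁) u)} ∪
      ⋃ m, {u | ¬ BlockGood j m (choices (labelKeep n p₁) u)} := by
    intro u _
    by_cases hu : ∀ m, BlockGood j m (choices (labelKeep n p₁) u)
    · exact Or.inl hu
    · push Not at hu
      exact Or.inr (mem_iUnion.2 hu)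
  have h1 := (measure_mono (μ := labelMeasure n) hcov).trans (measure_union_le _ _)
  rw [measure_univ, hnull, zero_add] at h1
  have h2 := h1.trans hU
  rw [ENNReal.one_le_ofReal] at h2
  linarith

end Supercritical

/-! ### The critical probability -/

section Critical

variable {n : ℕ}

/-- The choices whose limit set has topological Hausdorff dimension at most `d`. -/
def thinChoices (n : ℕ) (d : ℝ) : Set (Set (List (Pos n) × Pos n)) :=
  {K | ∀ s : ℝ, d - 1 < s → IsZeroDimMod s (limitSet K)}

theorem topHausdorffDim_limitSet_le_iff [NeZero n] {d : ℝ} (hd : 0 ≤ d)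
    {K : Set (List (Pos n) × Pos n)} :
    topHausdorffDim (limitSet K) ≤ (d : EReal) ↔ K ∈ thinChoices n d :=
  ⟨fun h _ hs => isZeroDimMod_of_topHausdorffDim_le (isCompact_limitSet K) h hs,
    fun h => topHausdorffDim_le_of_isZeroDimMod (isCompact_limitSet K) hd h⟩

theorem measurableSet_thinChoices [NeZero n] (d : ℝ) : MeasurableSet (thinChoices n d) := by
  have : thinChoices n d =
      ⋂ m : ℕ, {K | IsZeroDimMod (d - 1 + 1 / ((m : ℝ) + 1)) (limitSet K)} := by
    ext K
    simp only [thinChoices, mem_ofPred_eq, mem_iInter]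
    constructor
    · exact fun h m => h _ (lt_add_of_pos_right _ (by positivity))
    · intro h s hs
      obtain ⟨m, hm⟩ := exists_nat_one_div_lt (sub_pos.2 hs)
      exact (h m).mono_dim (by linarith)
  rw [this]
  exact .iInter fun m => measurableSet_isZeroDimMod _

theorem mem_thinChoices_iff [NeZero n] {d : ℝ} (K : Set (List (Pos n) × Pos n)) :
    K ∈ thinChoices n d ↔ ∀ a, ([], a) ∈ K → shift K [a] ∈ thinChoices n d := by
  simp only [thinChoices, mem_ofPred_eq]
  constructor
  · exact fun h a ha s hs => isZeroDimMod_limitSet_iff.1 (h s hs) a ha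
  · exact fun h s hs => isZeroDimMod_limitSet_iff.2 fun a ha => h a ha s hs

theorem mem_thinChoices_of_limitSet_eq_empty {d : ℝ} {K : Set (List (Pos n) × Pos n)}
    (h : limitSet K = ∅) : K ∈ thinChoices n d := fun s _ => h ▸ isZeroDimMod_empty s

/-- The probability that the topological Hausdorff dimension of the limit set is at most `d`. -/
noncomputable def thinProb (n : ℕ) (d p : ℝ) : ℝ :=
  (labelMeasure n).real {u | choices (labelKeep n p) u ∈ thinChoices n d}

theorem thinProb_antitone (d : ℝ) : Antitone (thinProb n d) := fun _ _ hp =>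
  measureReal_mono fun u hu s hs => (hu s hs).mono (limitSet_mono (choices_labelKeep_mono hp u))

theorem thinProb_eq_pow [NeZero n] (d : ℝ) {p : ℝ} (hp0 : 0 ≤ p) (hp1 : p ≤ 1) :
    thinProb n d p = (1 - p * (1 - thinProb n d p)) ^ Fintype.card (Pos n) :=
  (isPercolation_labelKeep hp0 hp1).measureReal_eq_pow hp0 (measurableSet_thinChoices d)
    mem_thinChoices_iff

theorem thinProb_le_one (d p : ℝ) : thinProb n d p ≤ 1 := measureReal_le_one

theorem IsPercolation.measureReal_thinChoices [NeZero n] {Ω : Type*} [MeasurableSpace Ω]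
    {P : Measure Ω} [IsProbabilityMeasure P] {p : ℝ} {keep : List (Pos n) × Pos n → Set Ω}
    (h : IsPercolation P p keep) (hp0 : 0 ≤ p) (hp1 : p ≤ 1) (d : ℝ) :
    P.real {ω | choices keep ω ∈ thinChoices n d} = thinProb n d p := by
  rw [thinProb, measureReal_def, measureReal_def,
    h.measure_choices_eq (isPercolation_labelKeep hp0 hp1) (measurableSet_thinChoices d)]

theorem exists_thinProb_lt_one [NeZero n] (hn : 2 ≤ n) {d : ℝ} (hd : d < 2) :
    ∃ p₁ : ℝ, 0 < p₁ ∧ p₁ < 1 ∧ thinProb n d p₁ < 1 := by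
  obtain ⟨s, hs0, hs1⟩ : ∃ s, max 0 (d - 1) < s ∧ s < 1 :=
    exists_between (max_lt one_pos (by linarith))
  obtain ⟨j, hj⟩ := exists_block_length hn hs1
  obtain ⟨p₁, h0, h1, hpos⟩ := exists_retention_blockGood n j
  refine ⟨p₁, h0, h1, lt_of_le_of_ne (thinProb_le_one d p₁) fun h => hpos ?_⟩
  have hm := measurableSet_preimage
    (isPercolation_labelKeep (n := n) h0.le h1.le).measurable_choices
    (measurableSet_thinChoices (n := n) d)
  refine measure_mono_null (t := (choices (labelKeep n p₁) ⁻¹' thinChoices n d)ᶜ)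
    (fun u hu hthin => ?_) ?_
  · exact not_isZeroDimMod_of_blockGood ((le_max_left _ _).trans_lt hs0) hj hu
      (hthin s ((le_max_right _ _).trans_lt hs0))
  · have h2 := probReal_compl_eq_one_sub (μ := labelMeasure n) hm
    have h3 : (labelMeasure n).real (choices (labelKeep n p₁) ⁻¹' thinChoices n d) = 1 := h
    rw [h3, sub_self, measureReal_eq_zero_iff] at h2
    exact h2

/-- The zero-one law: if the dimension exceeds `d` with positive probability, then it does so almost
surely on survival. -/
theorem IsPercolation.ae_notMem_thinChoices [NeZero n] (hn : 2 ≤ n) {Ω : Type*} [MeasurableSpace Ω]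
    {P : Measure Ω} [IsProbabilityMeasure P] {p : ℝ} {keep : List (Pos n) × Pos n → Set Ω}
    (h : IsPercolation P p keep) (hp0 : 0 < p) (hp1 : p ≤ 1) {d : ℝ} (hd : thinProb n d p < 1) :
    ∀ᵐ ω ∂P, limitSet (choices keep ω) ≠ ∅ → choices keep ω ∉ thinChoices n d := by
  have hcard : 2 ≤ Fintype.card (Pos n) := by
    simp only [Fintype.card_pi, Fintype.card_fin, Finset.prod_const, Finset.card_univ]
    nlinarith
  have hB := measurableSet_preimage h.measurable_choices (measurableSet_thinChoices (n := n) d)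
  have hE := measurableSet_preimage h.measurable_choices (measurableSet_limitSet_eq_empty (n := n))
  have hsub : choices keep ⁻¹' {K | limitSet K = ∅} ⊆ choices keep ⁻¹' thinChoices n d :=
    fun ω hω => mem_thinChoices_of_limitSet_eq_empty hω
  have hx : P.real (choices keep ⁻¹' thinChoices n d) = thinProb n d p :=
    h.measureReal_thinChoices hp0.le hp1 d
  have hy := h.measureReal_eq_pow hp0.le (measurableSet_limitSet_eq_empty (n := n))
    fun K => limitSet_eq_empty_iff
  have hle := measureReal_mono (μ := P) hsub
  have heq := eq_of_fixedPoint hcard hp0 hp1 measureReal_nonneg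
    ((hle.trans_eq hx).trans_lt hd) measureReal_nonneg hd hy
    (thinProb_eq_pow d hp0.le hp1)
  have hnull : P.real (choices keep ⁻¹' thinChoices n d \ choices keep ⁻¹' {K | limitSet K = ∅}) =
      0 := by
    rw [measureReal_sdiff hsub hE, hx, sub_eq_zero]
    exact heq.symm
  rw [measureReal_eq_zero_iff] at hnull
  filter_upwards [compl_mem_ae_iff.2 hnull] with ω hω hne hthin
  exact hω ⟨hthin, hne⟩

theorem isTotallyDisconnected_of_mem_thinChoices {K : Set (List (Pos n) × Pos n)}
    (h : K ∈ thinChoices n 0) : IsTotallyDisconnected (limitSet K) :=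
  (h (-1 / 2) (by norm_num)).isTotallyDisconnected (by norm_num)

theorem exists_nontrivial_component_of_notMem_thinChoices [NeZero n] {d : ℝ}
    {K : Set (List (Pos n) × Pos n)} (h : K ∉ thinChoices n d) :
    ∃ x ∈ limitSet K, (connectedComponentIn (limitSet K) x).Nontrivial := by
  have h1 : ¬ IsTotallyDisconnected (limitSet K) := fun htd =>
    h fun s _ => .of_isTotallyDisconnected s (isCompact_limitSet K) htd
  unfold IsTotallyDisconnected at h1
  push Not at h1
  obtain ⟨t, htM, ht, htn⟩ := h1
  obtain ⟨x, hx⟩ := htn.nonempty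
  exact ⟨x, htM hx, htn.mono (ht.subset_connectedComponentIn hx htM)⟩

end Critical

end FractalPercolation

theorem theoremt (n : ℕ) (hn : 2 ≤ n) (d : ℝ) (hd0 : 0 ≤ d) (hd2 : d < 2) :
    ∃ pc : ℝ, 0 < pc ∧ pc < 1 ∧
      ∀ p : ℝ, 0 < p → p < 1 →
      ∀ (Ω : Type*) [MeasurableSpace Ω] (P : Measure Ω) [IsProbabilityMeasure P]
        (keep : List (FractalPercolation.Pos n) × FractalPercolation.Pos n → Set Ω),
        FractalPercolation.IsPercolation P p keep →
        (p < pc → ∀ᵐ ω ∂P,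
          topHausdorffDim (FractalPercolation.randomLimitSet keep ω) ≤ (d : EReal)) ∧
        (pc < p → ∀ᵐ ω ∂P, FractalPercolation.randomLimitSet keep ω ≠ ∅ →
          (d : EReal) < topHausdorffDim (FractalPercolation.randomLimitSet keep ω)) ∧
        (d = 0 →
          (p < pc → ∀ᵐ ω ∂P,
            IsTotallyDisconnected (FractalPercolation.randomLimitSet keep ω)) ∧
          (pc < p → 0 < P {ω | ∃ x ∈ FractalPercolation.randomLimitSet keep ω,
            (connectedComponentIn (FractalPercolation.randomLimitSet keep ω) x).Nontrivial})) := by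
  open FractalPercolation in
  have : NeZero n := ⟨by omega⟩
  set S : Set ℝ := {p | 0 < p ∧ p < 1 ∧ thinProb n d p = 1} with hS
  obtain ⟨p₁, hp₁0, hp₁1, hp₁⟩ := exists_thinProb_lt_one hn hd2
  have hbdd : BddAbove S := ⟨1, fun p hp => hp.2.1.le⟩
  -- below `1 / n ^ 2` the process dies out, as the mean offspring number is less than `1`
  obtain ⟨p₀, hp₀0, hp₀⟩ : ∃ p₀ : ℝ, 0 < p₀ ∧ p₀ ∈ S := by
    have hc : (4 : ℝ) ≤ Fintype.card (Pos n) := by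
      have : 4 ≤ Fintype.card (Pos n) := by
        simp only [Fintype.card_pi, Fintype.card_fin, Finset.prod_const, Finset.card_univ]
        nlinarith
      exact_mod_cast this
    have h0 : (0 : ℝ) < 1 / (2 * Fintype.card (Pos n)) := by positivity
    have h1 : 1 / (2 * (Fintype.card (Pos n) : ℝ)) < 1 := by
      rw [div_lt_one (by positivity)]
      linarith
    refine ⟨_, h0, h0, h1, ?_⟩
    refine eq_one_of_fixedPoint h0.le h1.le ?_ measureReal_nonneg (thinProb_le_one d _)
      (thinProb_eq_pow d h0.le h1.le)
    rw [mul_one_div, div_lt_one (by positivity)]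
    linarith
  have hle : ∀ p ∈ S, p ≤ p₁ := fun p hp => by
    by_contra! hlt
    exact ((thinProb_antitone d hlt.le).trans_lt hp₁).ne hp.2.2
  refine ⟨sSup S, hp₀0.trans_le (le_csSup hbdd hp₀),
    (csSup_le ⟨p₀, hp₀⟩ hle).trans_lt hp₁1, ?_⟩
  intro p hp0 hp1 Ω _ P _ keep h
  have hB := measurableSet_preimage h.measurable_choices (measurableSet_thinChoices (n := n) d)
  have hP : P.real (choices keep ⁻¹' thinChoices n d) = thinProb n d p :=
    h.measureReal_thinChoices hp0.le hp1.le d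
  have hsub : p < sSup S → ∀ᵐ ω ∂P, choices keep ω ∈ thinChoices n d := by
    intro hp
    obtain ⟨p', hp', hpp'⟩ := exists_lt_of_lt_csSup ⟨p₀, hp₀⟩ hp
    have h1 : thinProb n d p = 1 :=
      le_antisymm (thinProb_le_one d p) (hp'.2.2 ▸ thinProb_antitone d hpp'.le)
    have h2 := probReal_compl_eq_one_sub (μ := P) hB
    rw [hP, h1, sub_self, measureReal_eq_zero_iff] at h2
    filter_upwards [compl_mem_ae_iff.2 h2] with ω hω
    exact not_not.1 hω
  have hlt : sSup S < p → thinProb n d p < 1 := fun hp =>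
    lt_of_le_of_ne (thinProb_le_one d p) fun h1 =>
      hp.not_ge (le_csSup hbdd ⟨hp0, hp1, h1⟩)
  refine ⟨fun hp => ?_, fun hp => ?_, ?_⟩
  · filter_upwards [hsub hp] with ω hω
    exact (topHausdorffDim_limitSet_le_iff hd0).2 hω
  · filter_upwards [h.ae_notMem_thinChoices hn hp0 hp1.le (hlt hp)] with ω hω hne
    exact not_le.1 fun hle => hω hne ((topHausdorffDim_limitSet_le_iff hd0).1 hle)
  · rintro rfl
    refine ⟨fun hp => ?_, fun hp => ?_⟩
    · filter_upwards [hsub hp] with ω hω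
      exact isTotallyDisconnected_of_mem_thinChoices hω
    · have h1 : 0 < P.real (choices keep ⁻¹' thinChoices n 0)ᶜ := by
        rw [probReal_compl_eq_one_sub hB, hP]
        linarith [hlt hp]
      rw [measureReal_def, ENNReal.toReal_pos_iff] at h1
      exact h1.1.trans_le (measure_mono fun ω hω =>
        exists_nontrivial_component_of_notMem_thinChoices hω)
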